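/- Let $\alpha\in\mathbb{R}$ and consider, for $t>0$ and $x\in\mathbb{R}$, the viscous transonic equation $$u_{tt}=-u_{xxx}+u_xu_{xx}-\frac{\alpha}{t}u_t .$$ Let $\mathcal F$ be the algebra of smooth real functions, each depending on finitely many of the variables $t>0$, $x$, $u_k=\partial_x^k u$, $v_k=\partial_x^k u_t$ ($k\ge 0$), all of which except $t$ range over $\mathbb{R}$. Put $F=-u_3+u_1u_2-\frac{\alpha}{t}v_0$ and let $$\bar D_x=\partial_x+\sum_{k\ge0}u_{k+1}\partial_{u_k}+\sum_{k\ge0}v_{k+1}\partial_{v_k},\qquad \bar D_t=\partial_t+\sum_{k\ge0}v_k\partial_{u_k}+\sum_{k\ge0}\bar D_x^k(F)\,\partial_{v_k}$$ be the total derivatives restricted to the equation. A conserved current is a pair $(J_0,J_1)\in\mathcal F^2$ with $\bar D_tJ_0+\bar D_xJ_1=0$; it is trivial if $J_0=-\bar D_x\mathcal L$, $J_1=\bar D_t\mathcal L$ for some $\mathcal L\in\mathcal F$; two conserved currents are equivalent if they differ by a trivial one, and a conservation law is an equivalence class of conserved currents. The characteristic of the conservation law of $(J_0,J_1)$ is $\chi=\sum_{k\ge0}(-1)^k\bar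 D_x^k\bigl(\partial J_0/\partial v_k\bigr)$. Then $$\Bigl(u_tt^\alpha,\;u_{xx}t^\alpha-\frac{u_x^2}{2}t^\alpha\Bigr)\quad\text{and}\quad \Bigl(u_tt+(\alpha-1)u,\;u_{xx}t-\frac{u_x^2}{2}t\Bigr)$$ are conserved currents, and every conserved current equivalent to the first (respectively, the second) has characteristic $t^\alpha$ (respectively, $t$). Moreover, if $\alpha\neq1$, then every conservation law of the equation is a linear combination with real constant coefficients of the conservation laws of these two currents; that is, every conserved current is equivalent to a real linear combination of them. -/

import Mathlib

open scoped ContDiff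

noncomputable section

namespace ViscousTransonic

/-- The coordinates on the infinite prolongation of `u_tt = -u_xxx + u_x u_xx - (α/t) u_t`:
the independent variables `t`, `x`, and the derivatives `u k = ∂ₓᵏ u` and `ut k = ∂ₓᵏ u_t`.
All other derivatives of `u` are expressed through these by the equation. -/
inductive Coord : Type
  | t : Coord
  | x : Coord
  | u : ℕ → Coord
  | ut : ℕ → Coord
  deriving DecidableEq

/-- The points of the prolonged equation: the coordinates take arbitrary real values,
subject only to `0 < t`. -/
abbrev JetSpace : Type := {p : Coord → ℝ // 0 < p Coord.t}

/-- The value of a coordinate, as a function on the prolonged equation. -/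
def coord (c : Coord) : JetSpace → ℝ := fun p => p.1 c

/-- Smooth functions on the prolonged equation that depend on finitely many coordinates only. -/
def IsSmoothFun (f : JetSpace → ℝ) : Prop :=
  ∃ (S : Finset Coord) (g : (S → ℝ) → ℝ),
    ContDiffOn ℝ ∞ g {q | ∀ h : Coord.t ∈ S, 0 < q ⟨Coord.t, h⟩} ∧
    ∀ p : JetSpace, f p = g (fun c => p.1 c)

/-- The partial derivative `∂f/∂c`. The extension of `f` by zero to `t ≤ 0` is immaterial,
since the derivative is only taken at points with `0 < t`. -/
def pd (c : Coord) (f : JetSpace → ℝ) : JetSpace → ℝ := fun p =>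
  deriv (fun s : ℝ => Function.extend Subtype.val f 0 (Function.update p.1 c s)) (p.1 c)

/-- The total derivative with respect to `x`, restricted to the equation. -/
def Dx (f : JetSpace → ℝ) : JetSpace → ℝ := fun p =>
  pd Coord.x f p
    + ∑ᶠ k : ℕ, coord (Coord.u (k + 1)) p * pd (Coord.u k) f p
    + ∑ᶠ k : ℕ, coord (Coord.ut (k + 1)) p * pd (Coord.ut k) f p

/-- The right-hand side `-u_xxx + u_x u_xx - (α/t) u_t` of the equation. -/
def rhs (α : ℝ) : JetSpace → ℝ := fun p =>
  -coord (Coord.u 3) p + coord (Coord.u 1) p * coord (Coord.u 2) p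
    - α / coord Coord.t p * coord (Coord.ut 0) p

/-- The total derivative with respect to `t`, restricted to the equation. -/
def Dt (α : ℝ) (f : JetSpace → ℝ) : JetSpace → ℝ := fun p =>
  pd Coord.t f p
    + ∑ᶠ k : ℕ, coord (Coord.ut k) p * pd (Coord.u k) f p
    + ∑ᶠ k : ℕ, (Dx^[k] (rhs α)) p * pd (Coord.ut k) f p

/-- Pairs `(J₀, J₁)` of functions on the prolonged equation; `J₀` is the `t`-component and
`J₁` the `x`-component. -/
abbrev Current : Type := (JetSpace → ℝ) × (JetSpace → ℝ)

/-- Conserved currents: pairs of smooth functions with `D_t J₀ + D_x J₁ = 0` on the equation. -/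
def IsConserved (α : ℝ) (J : Current) : Prop :=
  IsSmoothFun J.1 ∧ IsSmoothFun J.2 ∧ Dt α J.1 + Dx J.2 = 0

/-- Trivial currents: `J₀ = -D_x ℒ`, `J₁ = D_t ℒ` for a smooth function `ℒ` on the equation. -/
def IsTrivial (α : ℝ) (J : Current) : Prop :=
  ∃ L : JetSpace → ℝ, IsSmoothFun L ∧ J.1 = -Dx L ∧ J.2 = Dt α L

/-- Two currents are equivalent if they differ by a trivial one. A conservation law is an
equivalence class of conserved currents. -/
def Equivalent (α : ℝ) (J J' : Current) : Prop := IsTrivial α (J - J')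

/-- The expression `∑ₖ (-D_x)ᵏ (∂J₀/∂(∂ₓᵏ u_t))` that computes the characteristic. -/
def characteristic (J : Current) : JetSpace → ℝ := fun p =>
  ∑ᶠ k : ℕ, (-1 : ℝ) ^ k * (Dx^[k] (pd (Coord.ut k) J.1)) p

/-- `χ` is the characteristic of the conservation law represented by the conserved current `J`:
it is the characteristic of every conserved current equivalent to `J`. -/
def IsCharacteristicOf (α : ℝ) (J : Current) (χ : JetSpace → ℝ) : Prop :=
  ∀ J' : Current, IsConserved α J' → Equivalent α J' J → characteristic J' = χ

/-- The current `(u_t t^α, u_xx t^α - (u_x² / 2) t^α)`. -/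
def currentA (α : ℝ) : Current :=
  (fun p => coord (Coord.ut 0) p * coord Coord.t p ^ α,
   fun p => coord (Coord.u 2) p * coord Coord.t p ^ α
      - coord (Coord.u 1) p ^ 2 / 2 * coord Coord.t p ^ α)

/-- The current `(u_t t + (α - 1) u, u_xx t - (u_x² / 2) t)`. -/
def currentB (α : ℝ) : Current :=
  (fun p => coord (Coord.ut 0) p * coord Coord.t p + (α - 1) * coord (Coord.u 0) p,
   fun p => coord (Coord.u 2) p * coord Coord.t p
      - coord (Coord.u 1) p ^ 2 / 2 * coord Coord.t p)

end ViscousTransonic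

end

/-!
Smooth functions of finitely many coordinates form an algebra on which `D_x` and `D_t` are commuting
derivations. Comparing the Euler operators `E_u`, `E_{u_t}` with `D_t` and using
`D_t J₀ = -D_x J₁`, one sees that the characteristic `χ = E_{u_t} J₀` of a conserved current
satisfies
`D_t² χ - D_t ((α/t) χ) = D_x³ χ + D_x (u_x D_x χ)`.

Give `∂ₓᵏ u` and `∂ₓᵏ u_t` the weights `2k` and `2k + 3`. If `c` is the coordinate of largest weight
in `χ`, then with respect to the coordinate three `x`-derivatives above `c` the terms `D_t² χ` and
`D_x³ χ` have the derivatives `-∂χ/∂c` and `∂χ/∂c`, while the other terms do not depend on it.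
Hence `χ` is a function of `t` and `x`; the term with `u_xx` then gives `∂χ/∂x = 0`, and
`χ' - (α/t) χ` is constant, so that `χ = a t^α + b t` when `α ≠ 1`.

It remains to see that a conserved current with `χ = 0` is trivial. In this case `E_u J₀ = 0` too,
and the Euler complex is exact: the coordinate of highest order enters `J₀` affinely and is removed
by subtracting the total `x`-derivative of a primitive, until only a function of `t` and `x` is
left.
-/

noncomputable section

namespace ViscousTransonic

open Set MeasureTheory Filter
open scoped Interval Topology

universe u

section ParametricIntegral

theorem exists_forall_norm_le_near_slice {X Y F : Type*} [TopologicalSpace X] [TopologicalSpace Y]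
    [SeminormedAddCommGroup F] {V : Set (X × Y)} (hV : IsOpen V) {f : X × Y → F}
    (hf : ContinuousOn f V) {K : Set X} (hK : IsCompact K) {y : Y} (hKy : ∀ x ∈ K, (x, y) ∈ V) :
    ∃ C, ∀ᶠ y' in 𝓝 y, ∀ x ∈ K, (x, y') ∈ V ∧ ‖f (x, y')‖ ≤ C := by
  have hslice : ContinuousOn (fun x => f (x, y)) K := hf.comp (by fun_prop) hKy
  obtain ⟨C, hC⟩ := hK.exists_bound_of_continuousOn hslice
  have hopen : IsOpen (V ∩ (fun z => ‖f z‖) ⁻¹' Iio (C + 1)) :=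
    hf.norm.isOpen_inter_preimage hV isOpen_Iio
  have hsub : K ×ˢ {y} ⊆ V ∩ (fun z => ‖f z‖) ⁻¹' Iio (C + 1) := by
    rintro ⟨x, _⟩ ⟨hx, rfl⟩
    exact ⟨hKy x hx, (hC x hx).trans_lt (lt_add_one C)⟩
  obtain ⟨U, W, -, hW, hKU, hyW, hUW⟩ :=
    generalized_tube_lemma hK isCompact_singleton hopen hsub
  refine ⟨C + 1, ?_⟩
  filter_upwards [hW.mem_nhds (hyW rfl)] with y' hy' x hx
  obtain ⟨hmem, hlt⟩ := hUW (mk_mem_prod (hKU hx) hy')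
  exact ⟨hmem, hlt.le⟩

variable {E F : Type u} [NormedAddCommGroup E] [NormedSpace ℝ E] [NormedAddCommGroup F]
  [NormedSpace ℝ F] {V : Set (ℝ × E)} {a b : ℝ}

theorem hasFDerivAt_intervalIntegral_of_contDiffOn (hV : IsOpen V) {f : ℝ × E → F}
    (hf : ContDiffOn ℝ 1 f V) {x : E} (hx : ∀ s ∈ [[a, b]], (s, x) ∈ V) :
    HasFDerivAt (fun x => ∫ s in a..b, f (s, x))
      (∫ s in a..b, (fderiv ℝ f (s, x)).comp (.inr ℝ ℝ E)) x := by
  have hf' : ContinuousOn (fun z => (fderiv ℝ f z).comp (.inr ℝ ℝ E)) V :=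
    (hf.continuousOn_fderiv_of_isOpen hV le_rfl).clm_comp continuousOn_const
  have intervalIntegrable_slice {G : Type u} [NormedAddCommGroup G] {k : ℝ × E → G}
      (hk : ContinuousOn k V) {y : E} (hy : ∀ s ∈ [[a, b]], (s, y) ∈ V) :
      IntervalIntegrable (fun s => k (s, y)) volume a b :=
    (hk.comp (by fun_prop) hy).intervalIntegrable
  obtain ⟨C, hC⟩ := exists_forall_norm_le_near_slice hV hf' isCompact_uIcc hx
  refine intervalIntegral.hasFDerivAt_integral_of_dominated_of_fderiv_le
    (bound := fun _ => C)
    (F' := fun y s => (fderiv ℝ f (s, y)).comp (.inr ℝ ℝ E)) hC ?_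
    (intervalIntegrable_slice hf.continuousOn hx)
    (intervalIntegrable_slice hf' hx).aestronglyMeasurable_restrict_uIoc ?_
    intervalIntegrable_const ?_
  · filter_upwards [hC] with y hy
    exact (intervalIntegrable_slice hf.continuousOn
      fun s hs => (hy s hs).1).aestronglyMeasurable_restrict_uIoc
  · exact .of_forall fun s hs y hy => (hy s (uIoc_subset_uIcc hs)).2
  · refine .of_forall fun s hs y hy => ?_
    have hdiff : DifferentiableAt ℝ f (s, y) :=
      (hf.differentiableOn one_ne_zero).differentiableAt
        (hV.mem_nhds (hy s (uIoc_subset_uIcc hs)).1)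
    exact hdiff.hasFDerivAt.comp y (hasFDerivAt_prodMk_right s y)

theorem contDiffOn_intervalIntegral (hV : IsOpen V) {U : Set E} (hU : IsOpen U)
    (hUV : [[a, b]] ×ˢ U ⊆ V) {n : ℕ∞} {f : ℝ × E → F} (hf : ContDiffOn ℝ n f V) :
    ContDiffOn ℝ n (fun x => ∫ s in a..b, f (s, x)) U := by
  refine contDiffOn_iff_forall_nat_le.2 fun m hm => ?_
  replace hf : ContDiffOn ℝ m f V := hf.of_le (mod_cast hm)
  clear hm
  have hslice {x : E} (hx : x ∈ U) : ∀ s ∈ [[a, b]], (s, x) ∈ V := fun s hs => hUV ⟨hs, hx⟩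
  induction m generalizing F with
  | zero =>
    refine contDiffOn_zero.2 fun x hx => ContinuousAt.continuousWithinAt ?_
    obtain ⟨C, hC⟩ := exists_forall_norm_le_near_slice hV hf.continuousOn isCompact_uIcc
      (hslice hx)
    refine intervalIntegral.continuousAt_of_dominated_interval (bound := fun _ => C) ?_ ?_
      intervalIntegrable_const ?_
    · filter_upwards [hC] with y hy
      exact (hf.continuousOn.comp (by fun_prop) fun s hs => (hy s hs).1 :
        ContinuousOn (fun s => f (s, y)) _).intervalIntegrable.aestronglyMeasurable_restrict_uIoc
    · filter_upwards [hC] with y hy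
      exact .of_forall fun s hs => (hy s (uIoc_subset_uIcc hs)).2
    · refine .of_forall fun s hs => ?_
      exact (hf.continuousOn.continuousAt
        (hV.mem_nhds (hslice hx s (uIoc_subset_uIcc hs)))).comp (by fun_prop)
  | succ m ih =>
    push_cast at hf ⊢
    have hderiv (x : E) (hx : x ∈ U) :=
      hasFDerivAt_intervalIntegral_of_contDiffOn hV (hf.of_le le_add_self) (hslice hx)
    refine (contDiffOn_succ_iff_fderiv_of_isOpen hU).2
      ⟨fun x hx => (hderiv x hx).differentiableAt.differentiableWithinAt, by simp, ?_⟩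
    refine (ih (f := fun z => (fderiv ℝ f z).comp (.inr ℝ ℝ E)) ?_).congr
      fun x hx => (hderiv x hx).fderiv
    exact (hf.fderiv_of_isOpen hV le_rfl).clm_comp contDiffOn_const

end ParametricIntegral

section LinePrimitive

variable {E F : Type u} [NormedAddCommGroup E] [NormedSpace ℝ E] [NormedAddCommGroup F]
  [NormedSpace ℝ F]

/-- The point at parameter `s` of the segment that runs in direction `e` from the hyperplane
`ℓ = a` (at `s = 0`) to `x` (at `s = 1`); here `ℓ e = 1`. -/
def slide (ℓ : E →L[ℝ] ℝ) (e : E) (a s : ℝ) (x : E) : E := x - ((1 - s) * (ℓ x - a)) • e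

/-- The primitive of `g` in direction `e` that vanishes on the hyperplane `ℓ = a`, written as an
integral over the unit interval; here `ℓ e = 1`. -/
def linePrimitive (ℓ : E →L[ℝ] ℝ) (e : E) (a : ℝ) (g : E → F) (x : E) : F :=
  ∫ s in (0 : ℝ)..1, (ℓ x - a) • g (slide ℓ e a s x)

variable {ℓ : E →L[ℝ] ℝ} {e : E} {a : ℝ} {U : Set E} {g : E → F}

theorem slide_one (x : E) : slide ℓ e a 1 x = x := by simp [slide]

theorem contDiff_slide : ContDiff ℝ ∞ fun z : ℝ × E => slide ℓ e a z.1 z.2 := by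
  unfold slide
  fun_prop

theorem slide_mem (hUc : Convex ℝ U) (hbase : ∀ x ∈ U, x - (ℓ x - a) • e ∈ U) {s : ℝ}
    (hs : s ∈ [[0, 1]]) {x : E} (hx : x ∈ U) : slide ℓ e a s x ∈ U := by
  rw [uIcc_of_le zero_le_one] at hs
  convert hUc (hbase x hx) hx (sub_nonneg.2 hs.2) hs.1 (sub_add_cancel 1 s) using 1
  simp only [slide]
  module

theorem isOpen_slide_preimage (hU : IsOpen U) : IsOpen {z : ℝ × E | slide ℓ e a z.1 z.2 ∈ U} :=
  hU.preimage contDiff_slide.continuous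

theorem contDiffOn_integrand_linePrimitive {n : ℕ∞} (hg : ContDiffOn ℝ n g U) :
    ContDiffOn ℝ n (fun z : ℝ × E => (ℓ z.2 - a) • g (slide ℓ e a z.1 z.2))
      {z | slide ℓ e a z.1 z.2 ∈ U} := by
  refine ContDiffOn.smul (ContDiff.contDiffOn (by fun_prop)) ?_
  exact hg.comp (contDiff_slide.of_le (mod_cast le_top)).contDiffOn fun z hz => hz

theorem contDiffOn_linePrimitive (hU : IsOpen U) (hUc : Convex ℝ U)
    (hbase : ∀ x ∈ U, x - (ℓ x - a) • e ∈ U) {n : ℕ∞} (hg : ContDiffOn ℝ n g U) :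
    ContDiffOn ℝ n (linePrimitive ℓ e a g) U :=
  contDiffOn_intervalIntegral (isOpen_slide_preimage hU) hU
    (fun _ hz => slide_mem hUc hbase hz.1 hz.2) (contDiffOn_integrand_linePrimitive hg)

theorem hasFDerivAt_slide (s : ℝ) (x : E) :
    HasFDerivAt (slide ℓ e a s) (.id ℝ E - ((1 - s) • ℓ).smulRight e) x :=
  (hasFDerivAt_id x).sub (((ℓ.hasFDerivAt.sub_const a).const_smul (1 - s)).smul_const e)

theorem hasDerivAt_slide (s : ℝ) (x : E) :
    HasDerivAt (fun s => slide ℓ e a s x) ((ℓ x - a) • e) s := by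
  have h : HasDerivAt (fun s : ℝ => (1 - s) * (ℓ x - a)) (-1 * (ℓ x - a)) s :=
    ((hasDerivAt_id s).const_sub 1).mul_const (ℓ x - a)
  simpa only [slide, neg_one_mul, neg_smul, neg_neg] using (h.smul_const e).const_sub x

theorem fderiv_linePrimitive (hU : IsOpen U) (hUc : Convex ℝ U)
    (hbase : ∀ x ∈ U, x - (ℓ x - a) • e ∈ U) (hg : ContDiffOn ℝ 1 g U) {x : E} (hx : x ∈ U)
    (v : E) :
    fderiv ℝ (linePrimitive ℓ e a g) x v =
      ∫ s in (0 : ℝ)..1, ((ℓ x - a) • fderiv ℝ g (slide ℓ e a s x) (v - ((1 - s) * ℓ v) • e) +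
        ℓ v • g (slide ℓ e a s x)) := by
  set f : ℝ × E → F := fun z => (ℓ z.2 - a) • g (slide ℓ e a z.1 z.2)
  have hV := isOpen_slide_preimage (ℓ := ℓ) (e := e) (a := a) hU
  have hf : ContDiffOn ℝ 1 f _ := contDiffOn_integrand_linePrimitive hg
  have hmem (s : ℝ) (hs : s ∈ [[0, 1]]) : slide ℓ e a s x ∈ U := slide_mem hUc hbase hs hx
  have hcont : ContinuousOn (fun s : ℝ => (fderiv ℝ f (s, x)).comp (.inr ℝ ℝ E)) [[0, 1]] :=
    ((hf.continuousOn_fderiv_of_isOpen hV le_rfl).comp (by fun_prop) fun s hs =>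
      hmem s hs).clm_comp continuousOn_const
  rw [show fderiv ℝ (linePrimitive ℓ e a g) x = _ from
      (hasFDerivAt_intervalIntegral_of_contDiffOn hV hf hmem).fderiv,
    ContinuousLinearMap.intervalIntegral_apply hcont.intervalIntegrable]
  refine intervalIntegral.integral_congr fun s hs => ?_
  have hfs : DifferentiableAt ℝ f (s, x) :=
    (hf.differentiableOn one_ne_zero).differentiableAt (hV.mem_nhds (hmem s hs))
  have hgs : DifferentiableAt ℝ g (slide ℓ e a s x) :=
    (hg.differentiableOn one_ne_zero).differentiableAt (hU.mem_nhds (hmem s hs))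
  have hpartial := (hfs.hasFDerivAt.comp x (hasFDerivAt_prodMk_right s x)).unique
    ((ℓ.hasFDerivAt.sub_const a).smul (hgs.hasFDerivAt.comp x (hasFDerivAt_slide s x)))
  simpa using DFunLike.congr_fun hpartial v

theorem fderiv_linePrimitive_self [CompleteSpace F] (he : ℓ e = 1) (hU : IsOpen U)
    (hUc : Convex ℝ U) (hbase : ∀ x ∈ U, x - (ℓ x - a) • e ∈ U) (hg : ContDiffOn ℝ 1 g U) {x : E}
    (hx : x ∈ U) : fderiv ℝ (linePrimitive ℓ e a g) x e = g x := by
  have hmem (s : ℝ) (hs : s ∈ [[0, 1]]) := slide_mem hUc hbase hs hx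
  have hderiv : ∀ s ∈ [[(0 : ℝ), 1]], HasDerivAt (fun s => s • g (slide ℓ e a s x))
      (s • fderiv ℝ g (slide ℓ e a s x) ((ℓ x - a) • e) + (1 : ℝ) • g (slide ℓ e a s x)) s := by
    intro s hs
    have hgs : DifferentiableAt ℝ g (slide ℓ e a s x) :=
      (hg.differentiableOn one_ne_zero).differentiableAt (hU.mem_nhds (hmem s hs))
    exact (hasDerivAt_id s).smul (hgs.hasFDerivAt.comp_hasDerivAt s (hasDerivAt_slide s x))
  have hslide : ContinuousOn (fun s => slide ℓ e a s x) [[(0 : ℝ), 1]] :=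
    (contDiff_slide.continuous.comp (by fun_prop : Continuous fun s : ℝ => (s, x))).continuousOn
  have hint : IntervalIntegrable (fun s : ℝ => s • fderiv ℝ g (slide ℓ e a s x) ((ℓ x - a) • e) +
      (1 : ℝ) • g (slide ℓ e a s x)) volume 0 1 :=
    (((continuousOn_id.smul (((hg.continuousOn_fderiv_of_isOpen hU le_rfl).comp hslide
      hmem).clm_apply continuousOn_const)).add
        ((hg.continuousOn.comp hslide hmem).const_smul (1 : ℝ)))).intervalIntegrable
  calc fderiv ℝ (linePrimitive ℓ e a g) x e
      = ∫ s in (0 : ℝ)..1, (s • fderiv ℝ g (slide ℓ e a s x) ((ℓ x - a) • e) +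
          (1 : ℝ) • g (slide ℓ e a s x)) := by
        rw [fderiv_linePrimitive hU hUc hbase hg hx, he]
        refine intervalIntegral.integral_congr fun s _ => ?_
        have hes : e - ((1 - s) * 1) • e = s • e := by module
        simp only [hes, map_smul, smul_comm s]
    _ = g x := by
        rw [intervalIntegral.integral_eq_sub_of_hasDerivAt hderiv hint, slide_one]
        simp

theorem fderiv_linePrimitive_eq_zero (hU : IsOpen U) (hUc : Convex ℝ U)
    (hbase : ∀ x ∈ U, x - (ℓ x - a) • e ∈ U) (hg : ContDiffOn ℝ 1 g U) {v : E} (hv : ℓ v = 0)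
    (hgv : ∀ y ∈ U, fderiv ℝ g y v = 0) {x : E} (hx : x ∈ U) :
    fderiv ℝ (linePrimitive ℓ e a g) x v = 0 := by
  rw [fderiv_linePrimitive hU hUc hbase hg hx, intervalIntegral.integral_congr (g := fun _ => 0)]
  · simp
  · intro s hs
    simp [hv, hgv _ (slide_mem hUc hbase hs hx)]

end LinePrimitive

section Representation

/-- The values that the coordinates in `S` take on the prolonged equation. -/
def jetDomain (S : Finset Coord) : Set (S → ℝ) := {q | ∀ h : Coord.t ∈ S, 0 < q ⟨Coord.t, h⟩}

/-- The restriction of a point of the jet space, or of a tangent vector to it, to the coordinates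
in `S`. -/
abbrev restrict (S : Finset Coord) : (Coord → ℝ) → S → ℝ := S.restrict

/-- The function `f` on the prolonged equation is given by the smooth function `g` of the
coordinates in `S`. -/
structure Represents (S : Finset Coord) (g : (S → ℝ) → ℝ) (f : JetSpace → ℝ) : Prop where
  contDiffOn : ContDiffOn ℝ ∞ g (jetDomain S)
  eq_restrict (p : JetSpace) : f p = g (restrict S p.1)

variable {S T : Finset Coord} {g : (S → ℝ) → ℝ} {f : JetSpace → ℝ}

theorem isSmoothFun_iff : IsSmoothFun f ↔ ∃ S g, Represents S g f :=
  ⟨fun ⟨S, g, hg, hf⟩ => ⟨S, g, hg, hf⟩, fun ⟨S, g, hg, hf⟩ => ⟨S, g, hg, hf⟩⟩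

theorem isOpen_jetDomain (S : Finset Coord) : IsOpen (jetDomain S) := by
  simp only [jetDomain, ofPred_forall]
  exact isOpen_iInter_of_finite fun h => isOpen_lt continuous_const (continuous_apply _)

theorem convex_jetDomain (S : Finset Coord) : Convex ℝ (jetDomain S) := by
  simp only [jetDomain, ofPred_forall]
  exact convex_iInter fun h => convex_halfSpace_gt (LinearMap.proj _).isLinear 0

theorem restrict_mem_jetDomain (S : Finset Coord) (p : JetSpace) : restrict S p.1 ∈ jetDomain S :=
  fun _ => p.2

theorem exists_restrict_eq {q : S → ℝ} (hq : q ∈ jetDomain S) :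
    ∃ p : JetSpace, restrict S p.1 = q := by
  refine ⟨⟨fun c => if h : c ∈ S then q ⟨c, h⟩ else 1, ?_⟩, ?_⟩
  · by_cases h : Coord.t ∈ S
    · simpa [h] using hq h
    · simp [h]
  · ext c
    simp

theorem restrict_single (c : S) : restrict S (Pi.single (c : Coord) (1 : ℝ)) = Pi.single c 1 := by
  ext d
  simp [Pi.single_apply]

theorem restrict_single_of_notMem {c : Coord} (hc : c ∉ S) :
    restrict S (Pi.single c (1 : ℝ)) = 0 := by
  ext d
  simp [ne_of_mem_of_not_mem d.2 hc]

theorem Represents.enlarge (h : Represents S g f) (hST : S ⊆ T) :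
    Represents T (fun q => g fun c => q ⟨c, hST c.2⟩) f where
  contDiffOn := h.contDiffOn.comp
    (ContDiff.contDiffOn (by fun_prop)) fun _ hq ht => hq (hST ht)
  eq_restrict p := h.eq_restrict p

theorem IsSmoothFun.exists_represents (hf : IsSmoothFun f) (T : Finset Coord) :
    ∃ S g, T ⊆ S ∧ Represents S g f := by
  obtain ⟨S, g, h⟩ := isSmoothFun_iff.1 hf
  exact ⟨S ∪ T, _, Finset.subset_union_right, h.enlarge Finset.subset_union_left⟩

theorem Represents.differentiableAt (h : Represents S g f) (p : JetSpace) :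
    DifferentiableAt ℝ g (restrict S p.1) :=
  (h.contDiffOn.differentiableOn (by simp)).differentiableAt
    ((isOpen_jetDomain S).mem_nhds (restrict_mem_jetDomain S p))

theorem Represents.pd_apply (h : Represents S g f) (c : Coord) (p : JetSpace) :
    pd c f p = fderiv ℝ g (restrict S p.1) (restrict S (Pi.single c 1)) := by
  have hline : HasDerivAt (fun s => restrict S (Function.update p.1 c s))
      (restrict S (Pi.single c 1)) (p.1 c) := by
    refine hasDerivAt_pi.2 fun d => ?_
    obtain hd | hd := eq_or_ne (d : Coord) c
    · simpa [Finset.restrict, Function.update_apply, Pi.single_apply, hd] using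
        hasDerivAt_id' (p.1 c)
    · simpa [Finset.restrict, Function.update_apply, Pi.single_apply, hd] using
        hasDerivAt_const (p.1 c) (p.1 d)
  have hpos : ∀ᶠ s in 𝓝 (p.1 c), 0 < Function.update p.1 c s Coord.t := by
    have hcont : Continuous fun s => Function.update p.1 c s Coord.t :=
      (continuous_apply (A := fun _ : Coord => ℝ) Coord.t).comp
        (continuous_const.update c continuous_id)
    exact hcont.continuousAt.eventually_const_lt (by simpa using p.2)
  refine HasDerivAt.deriv (((h.differentiableAt p).hasFDerivAt.comp_hasDerivAt_of_eq (p.1 c) hline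
    (by simp)).congr_of_eventuallyEq ?_)
  filter_upwards [hpos] with s hs
  rw [Subtype.val_injective.extend_apply f 0 ⟨Function.update p.1 c s, hs⟩, h.eq_restrict]
  rfl

theorem Represents.pd (h : Represents S g f) (c : Coord) :
    Represents S (fun q => fderiv ℝ g q (restrict S (Pi.single c 1))) (pd c f) where
  contDiffOn := (h.contDiffOn.fderiv_of_isOpen (isOpen_jetDomain S) (by simp)).clm_apply
    contDiffOn_const
  eq_restrict := h.pd_apply c

theorem IsSmoothFun.pd (hf : IsSmoothFun f) (c : Coord) : IsSmoothFun (pd c f) := by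
  obtain ⟨S, g, h⟩ := isSmoothFun_iff.1 hf
  exact isSmoothFun_iff.2 ⟨S, _, h.pd c⟩

theorem Represents.pd_eq_zero_of_notMem (h : Represents S g f) {c : Coord} (hc : c ∉ S) :
    ViscousTransonic.pd c f = 0 := by
  ext p
  simp [h.pd_apply, restrict_single_of_notMem hc]

theorem IsSmoothFun.pd_comm (hf : IsSmoothFun f) (c d : Coord) :
    ViscousTransonic.pd c (ViscousTransonic.pd d f) =
      ViscousTransonic.pd d (ViscousTransonic.pd c f) := by
  obtain ⟨S, g, h⟩ := isSmoothFun_iff.1 hf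
  ext p
  have hg : ContDiffAt ℝ ∞ g (restrict S p.1) :=
    h.contDiffOn.contDiffAt ((isOpen_jetDomain S).mem_nhds (restrict_mem_jetDomain S p))
  have hdiff : DifferentiableAt ℝ (fderiv ℝ g) (restrict S p.1) :=
    (hg.fderiv_right (m := 1) (by norm_cast)).differentiableAt one_ne_zero
  have hsymm : IsSymmSndFDerivAt ℝ g (restrict S p.1) :=
    hg.isSymmSndFDerivAt (by simpa using WithTop.coe_le_coe.2 (le_top : (2 : ℕ∞) ≤ ⊤))
  rw [(h.pd d).pd_apply, (h.pd c).pd_apply, fderiv_clm_apply hdiff (by fun_prop),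
    fderiv_clm_apply hdiff (by fun_prop)]
  simpa using hsymm _ _

theorem IsSmoothFun.exists_eq_const (hf : IsSmoothFun f)
    (h0 : ∀ c, ViscousTransonic.pd c f = 0) : ∃ a : ℝ, ∀ p, f p = a := by
  obtain ⟨S, g, h⟩ := isSmoothFun_iff.1 hf
  have hfderiv : EqOn (fderiv ℝ g) 0 (jetDomain S) := by
    intro q hq
    obtain ⟨p, rfl⟩ := exists_restrict_eq hq
    refine ContinuousLinearMap.coe_injective (LinearMap.pi_ext' fun c => LinearMap.ext_ring ?_)
    simpa [h0, ← restrict_single] using (h.pd_apply c p).symm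
  refine ⟨g fun _ => 1, fun p => ?_⟩
  rw [h.eq_restrict]
  exact (isOpen_jetDomain S).is_const_of_fderiv_eq_zero (convex_jetDomain S).isPreconnected
    (h.contDiffOn.differentiableOn (by simp)) hfderiv (restrict_mem_jetDomain S p)
    fun _ => one_pos

theorem sub_smul_single_mem_jetDomain {q : S → ℝ} (hq : q ∈ jetDomain S) (c : S) :
    q - (q c - 1) • Pi.single c (1 : ℝ) ∈ jetDomain S := by
  intro ht
  obtain hc | hc := eq_or_ne (⟨Coord.t, ht⟩ : S) c
  · simp [hc]
  · simpa [hc] using hq ht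

theorem IsSmoothFun.exists_primitive (hf : IsSmoothFun f) (c : Coord) :
    ∃ F, IsSmoothFun F ∧ ViscousTransonic.pd c F = f ∧
      ∀ d ≠ c, ViscousTransonic.pd d f = 0 → ViscousTransonic.pd d F = 0 := by
  obtain ⟨S, g, hS, h⟩ := hf.exists_represents {c}
  let c' : S := ⟨c, Finset.singleton_subset_iff.1 hS⟩
  let ℓ : (S → ℝ) →L[ℝ] ℝ := .proj c'
  have hbase : ∀ q ∈ jetDomain S, q - (ℓ q - 1) • Pi.single c' (1 : ℝ) ∈ jetDomain S :=
    fun q hq => sub_smul_single_mem_jetDomain hq c'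
  have hg : ContDiffOn ℝ 1 g (jetDomain S) := h.contDiffOn.of_le (mod_cast le_top)
  have hF : Represents S (linePrimitive ℓ (Pi.single c' 1) 1 g)
      fun p => linePrimitive ℓ (Pi.single c' 1) 1 g (restrict S p.1) :=
    ⟨contDiffOn_linePrimitive (isOpen_jetDomain S) (convex_jetDomain S) hbase h.contDiffOn,
      fun p => rfl⟩
  refine ⟨_, isSmoothFun_iff.2 ⟨S, _, hF⟩, ?_, fun d hd hfd => ?_⟩
  · ext p
    rw [hF.pd_apply, h.eq_restrict, restrict_single c']
    exact fderiv_linePrimitive_self (by simp [ℓ]) (isOpen_jetDomain S) (convex_jetDomain S) hbase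
      hg (restrict_mem_jetDomain S p)
  · ext p
    rw [hF.pd_apply]
    refine fderiv_linePrimitive_eq_zero (isOpen_jetDomain S) (convex_jetDomain S) hbase hg
      (by simp [ℓ, c', hd.symm]) (fun q hq => ?_) (restrict_mem_jetDomain S p)
    obtain ⟨p, rfl⟩ := exists_restrict_eq hq
    rw [← h.pd_apply, hfd, Pi.zero_apply]

end Representation

section Algebra

theorem IsSmoothFun.exists_represents₂ {f g : JetSpace → ℝ} (hf : IsSmoothFun f)
    (hg : IsSmoothFun g) : ∃ S f' g', Represents S f' f ∧ Represents S g' g := by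
  obtain ⟨S, f', hf'⟩ := isSmoothFun_iff.1 hf
  obtain ⟨T, g', hST, hg'⟩ := hg.exists_represents S
  exact ⟨T, _, g', hf'.enlarge hST, hg'⟩

theorem Represents.add {S : Finset Coord} {f' g' : (S → ℝ) → ℝ} {f g : JetSpace → ℝ}
    (hf : Represents S f' f) (hg : Represents S g' g) : Represents S (f' + g') (f + g) :=
  ⟨hf.contDiffOn.add hg.contDiffOn, fun p => congr_arg₂ _ (hf.eq_restrict p) (hg.eq_restrict p)⟩

theorem Represents.mul {S : Finset Coord} {f' g' : (S → ℝ) → ℝ} {f g : JetSpace → ℝ}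
    (hf : Represents S f' f) (hg : Represents S g' g) : Represents S (f' * g') (f * g) :=
  ⟨hf.contDiffOn.mul hg.contDiffOn, fun p => congr_arg₂ _ (hf.eq_restrict p) (hg.eq_restrict p)⟩

theorem represents_const (S : Finset Coord) (a : ℝ) : Represents S (fun _ => a) fun _ => a :=
  ⟨contDiffOn_const, fun _ => rfl⟩

/-- The algebra `ℱ` of smooth functions of finitely many coordinates. -/
def smoothAlgebra : Subalgebra ℝ (JetSpace → ℝ) where
  carrier := {f | IsSmoothFun f}
  mul_mem' hf hg := by
    obtain ⟨S, f', g', hf', hg'⟩ := IsSmoothFun.exists_represents₂ hf hg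
    exact isSmoothFun_iff.2 ⟨S, _, hf'.mul hg'⟩
  add_mem' hf hg := by
    obtain ⟨S, f', g', hf', hg'⟩ := IsSmoothFun.exists_represents₂ hf hg
    exact isSmoothFun_iff.2 ⟨S, _, hf'.add hg'⟩
  algebraMap_mem' a := isSmoothFun_iff.2 ⟨∅, _, represents_const ∅ a⟩

/-- The elements of `smoothAlgebra`, as a type. It is not reducible, so that instance search finds
the ring structure by a single path. -/
def SmoothFun : Type := smoothAlgebra

instance : CommRing SmoothFun := inferInstanceAs (CommRing smoothAlgebra)

instance : Algebra ℝ SmoothFun := inferInstanceAs (Algebra ℝ smoothAlgebra)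

instance : IsAddTorsionFree SmoothFun := .of_isTorsionFree ℝ SmoothFun

instance : FunLike SmoothFun JetSpace ℝ where
  coe := Subtype.val
  coe_injective := Subtype.val_injective

theorem SmoothFun.isSmoothFun (f : SmoothFun) : IsSmoothFun f := f.2

/-- A smooth function, as an element of the algebra of smooth functions. -/
def IsSmoothFun.toSmoothFun {f : JetSpace → ℝ} (hf : IsSmoothFun f) : SmoothFun := Subtype.mk f hf

@[simp]
theorem IsSmoothFun.coe_toSmoothFun {f : JetSpace → ℝ} (hf : IsSmoothFun f) :
    ⇑hf.toSmoothFun = f := rfl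

namespace SmoothFun

@[simp]
theorem coe_zero : ⇑(0 : SmoothFun) = 0 := rfl

@[simp]
theorem coe_one : ⇑(1 : SmoothFun) = 1 := rfl

@[simp]
theorem coe_add (f g : SmoothFun) : ⇑(f + g) = f + g := rfl

@[simp]
theorem coe_neg (f : SmoothFun) : ⇑(-f) = -f := rfl

@[simp]
theorem coe_sub (f g : SmoothFun) : ⇑(f - g) = f - g := rfl

@[simp]
theorem coe_mul (f g : SmoothFun) : ⇑(f * g) = f * g := rfl

@[simp]
theorem coe_smul (a : ℝ) (f : SmoothFun) : ⇑(a • f) = a • ⇑f := rfl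

/-- Evaluation of smooth functions at a point, as an additive homomorphism. -/
def evalAt (p : JetSpace) : SmoothFun →+ ℝ where
  toFun f := f p
  map_zero' := rfl
  map_add' _ _ := rfl

end SmoothFun

/-- The partial derivative `∂/∂c` as a derivation of the algebra of smooth functions. -/
def pderiv (c : Coord) : Derivation ℝ SmoothFun SmoothFun :=
  .mk'
    { toFun f := (f.isSmoothFun.pd c).toSmoothFun
      map_add' f g := by
        obtain ⟨S, f', g', hf', hg'⟩ := f.isSmoothFun.exists_represents₂ g.isSmoothFun
        refine DFunLike.ext _ _ fun p => ((hf'.add hg').pd_apply c p).trans ?_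
        simp [hf'.pd_apply, hg'.pd_apply,
          fderiv_add (hf'.differentiableAt p) (hg'.differentiableAt p)]
      map_smul' a f := by
        obtain ⟨S, f', hf'⟩ := isSmoothFun_iff.1 f.isSmoothFun
        have haf : Represents S (fun q => a * f' q) (a • f : SmoothFun) :=
          (represents_const S a).mul hf'
        refine DFunLike.ext _ _ fun p => (haf.pd_apply c p).trans ?_
        simp [fderiv_const_mul (hf'.differentiableAt p), hf'.pd_apply] }
    fun f g => by
      obtain ⟨S, f', g', hf', hg'⟩ := f.isSmoothFun.exists_represents₂ g.isSmoothFun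
      refine DFunLike.ext _ _ fun p => ((hf'.mul hg').pd_apply c p).trans ?_
      simp [hf'.pd_apply, hg'.pd_apply, hf'.eq_restrict, hg'.eq_restrict,
        fderiv_mul (hf'.differentiableAt p) (hg'.differentiableAt p)]

theorem coe_pderiv (c : Coord) (f : SmoothFun) : ⇑(pderiv c f) = pd c f := rfl

theorem pderiv_comm (c d : Coord) (f : SmoothFun) :
    pderiv c (pderiv d f) = pderiv d (pderiv c f) :=
  DFunLike.coe_injective (f.isSmoothFun.pd_comm c d)

theorem exists_primitive (c : Coord) (f : SmoothFun) :
    ∃ F, pderiv c F = f ∧ ∀ d ≠ c, pderiv d f = 0 → pderiv d F = 0 := by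
  obtain ⟨F, hF, hcF, hdF⟩ := f.isSmoothFun.exists_primitive c
  exact ⟨hF.toSmoothFun, DFunLike.coe_injective hcF,
    fun d hd hdf => DFunLike.coe_injective (hdF d hd (congrArg DFunLike.coe hdf))⟩

theorem exists_eq_algebraMap {f : SmoothFun} (h : ∀ c, pderiv c f = 0) :
    ∃ a : ℝ, f = algebraMap ℝ SmoothFun a := by
  obtain ⟨a, ha⟩ := f.isSmoothFun.exists_eq_const fun c => congrArg DFunLike.coe (h c)
  exact ⟨a, DFunLike.coe_injective (funext ha)⟩

theorem finite_pderiv_ne_zero (f : SmoothFun) : {c | pderiv c f ≠ 0}.Finite := by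
  obtain ⟨S, f', hf'⟩ := isSmoothFun_iff.1 f.isSmoothFun
  exact S.finite_toSet.subset fun c hc =>
    not_imp_comm.1 (fun hcS => DFunLike.coe_injective (hf'.pd_eq_zero_of_notMem hcS)) hc

theorem represents_coord (c : Coord) :
    Represents {c} (fun q => q ⟨c, Finset.mem_singleton_self c⟩) (coord c) :=
  ⟨ContDiff.contDiffOn (by fun_prop), fun _ => rfl⟩

/-- The coordinate function `c` as an element of the algebra of smooth functions. -/
def X (c : Coord) : SmoothFun := (isSmoothFun_iff.2 ⟨_, _, represents_coord c⟩).toSmoothFun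

@[simp]
theorem coe_X (c : Coord) : ⇑(X c) = coord c := rfl

theorem pderiv_X (c d : Coord) : pderiv c (X d) = if c = d then 1 else 0 := by
  refine DFunLike.ext _ _ fun p => ((represents_coord d).pd_apply c p).trans ?_
  rw [(hasFDerivAt_apply (𝕜 := ℝ) (F' := fun _ => ℝ) _ _).fderiv]
  split_ifs with h <;> simp [h]

theorem represents_coord_rpow (a : ℝ) :
    Represents {Coord.t} (fun q => q ⟨Coord.t, Finset.mem_singleton_self _⟩ ^ a)
      fun p => coord Coord.t p ^ a :=
  ⟨ContDiffOn.rpow_const_of_ne (ContDiff.contDiffOn (by fun_prop))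
    fun _ hq => (hq (Finset.mem_singleton_self _)).ne', fun _ => rfl⟩

/-- The function `t ^ a`, for a real exponent `a`. -/
def tPow (a : ℝ) : SmoothFun :=
  (isSmoothFun_iff.2 ⟨_, _, represents_coord_rpow a⟩).toSmoothFun

@[simp]
theorem coe_tPow (a : ℝ) : ⇑(tPow a) = fun p => coord Coord.t p ^ a := rfl

theorem pderiv_tPow (c : Coord) (a : ℝ) :
    pderiv c (tPow a) = if c = Coord.t then a • tPow (a - 1) else 0 := by
  let t' : ({Coord.t} : Finset Coord) := ⟨Coord.t, Finset.mem_singleton_self _⟩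
  refine DFunLike.ext _ _ fun p => ((represents_coord_rpow a).pd_apply c p).trans ?_
  have ht : HasFDerivAt (fun q : ({Coord.t} : Finset Coord) → ℝ => q t' ^ a) _ (restrict _ p.1) :=
    (hasFDerivAt_apply (𝕜 := ℝ) (F' := fun _ => ℝ) t' _).rpow_const (.inl p.2.ne')
  rw [ht.fderiv]
  split_ifs with h <;> simp [h, t', coord]

theorem tPow_mul_tPow (a b : ℝ) : tPow a * tPow b = tPow (a + b) :=
  DFunLike.coe_injective (funext fun p => (Real.rpow_add p.2 a b).symm)

theorem tPow_zero : tPow 0 = 1 := DFunLike.coe_injective (funext fun _ => Real.rpow_zero _)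

theorem tPow_one : tPow 1 = X Coord.t := DFunLike.coe_injective (funext fun _ => Real.rpow_one _)

/-- The algebra of smooth functions that do not depend on the coordinates in `C`. -/
def independentOf (C : Set Coord) : Subalgebra ℝ SmoothFun where
  carrier := {f | ∀ c ∈ C, pderiv c f = 0}
  mul_mem' hf hg c hc := by simp [hf c hc, hg c hc]
  add_mem' hf hg c hc := by simp [hf c hc, hg c hc]
  algebraMap_mem' a c _ := (pderiv c).map_algebraMap a

theorem mem_independentOf {C : Set Coord} {f : SmoothFun} :
    f ∈ independentOf C ↔ ∀ c ∈ C, pderiv c f = 0 := Iff.rfl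

theorem pderiv_mem_independentOf {C : Set Coord} {f : SmoothFun} (hf : f ∈ independentOf C)
    (d : Coord) : pderiv d f ∈ independentOf C := fun c hc => by
  rw [pderiv_comm, hf c hc, map_zero]

end Algebra

section VectorFields

/-- The differential `∑ (∂f/∂c) dc` of a smooth function, as the finitely supported family of its
partial derivatives. -/
def differential : Derivation ℝ SmoothFun (Coord →₀ SmoothFun) where
  toFun f := Finsupp.onFinset (finite_pderiv_ne_zero f).toFinset (fun c => pderiv c f) (by simp)
  map_add' f g := by ext1 c; simp
  map_smul' a f := by ext1 c; simp
  map_one_eq_zero' := by ext1 c; simp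
  leibniz' f g := by ext1 c; simp

@[simp]
theorem differential_apply (f : SmoothFun) (c : Coord) : differential f c = pderiv c f := rfl

/-- The vector field `∑ G c ∂/∂c`, which is a finite sum on each smooth function. -/
def vectorField (G : Coord → SmoothFun) : Derivation ℝ SmoothFun SmoothFun :=
  (Finsupp.linearCombination SmoothFun G).compDer differential

variable {G : Coord → SmoothFun} {f : SmoothFun}

theorem vectorField_apply (G : Coord → SmoothFun) (f : SmoothFun) :
    vectorField G f = ∑ᶠ c, G c * pderiv c f := by
  have hsupp : (fun c => G c * pderiv c f).support ⊆ (differential f).support := by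
    intro c hc
    simpa using right_ne_zero_of_mul hc
  rw [finsum_eq_sum_of_support_subset _ hsupp]
  simp [vectorField, Finsupp.linearCombination_apply, Finsupp.sum, mul_comm]

theorem vectorField_eq_sum {S : Finset Coord} (hS : ∀ c ∉ S, G c = 0 ∨ pderiv c f = 0) :
    vectorField G f = ∑ c ∈ S, G c * pderiv c f := by
  rw [vectorField_apply]
  exact finsum_eq_sum_of_support_subset _ fun c hc =>
    by_contra fun hcS => hc <| by obtain h | h := hS c hcS <;> simp [h]

theorem vectorField_X (G : Coord → SmoothFun) (c : Coord) : vectorField G (X c) = G c := by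
  rw [vectorField_eq_sum (S := {c}) (by simp +contextual [pderiv_X])]
  simp [pderiv_X]

theorem vectorField_single (c : Coord) : vectorField (Pi.single c 1) = pderiv c := by
  ext1 f
  rw [vectorField_eq_sum (S := {c}) (by simp +contextual)]
  simp

theorem vectorField_eq_zero (h : ∀ c, G c = 0 ∨ pderiv c f = 0) : vectorField G f = 0 := by
  rw [vectorField_eq_sum (S := ∅) fun c _ => h c, Finset.sum_empty]

theorem lie_vectorField (G H : Coord → SmoothFun) :
    ⁅vectorField G, vectorField H⁆ =
      vectorField fun c => vectorField G (H c) - vectorField H (G c) := by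
  ext1 f
  let S := (differential f).support
  have hsum (K : Coord → SmoothFun) {g : SmoothFun} (hg : ∀ c, pderiv c f = 0 → pderiv c g = 0) :
      vectorField K g = ∑ c ∈ S, K c * pderiv c g :=
    vectorField_eq_sum fun c hc => .inr (hg c (by simpa [S] using hc))
  have happly (K L : Coord → SmoothFun) : vectorField K (vectorField L f) =
      ∑ c ∈ S, vectorField K (L c) * pderiv c f +
        ∑ c ∈ S, ∑ d ∈ S, L c * K d * pderiv d (pderiv c f) := by
    rw [hsum L fun _ => id, map_sum, ← Finset.sum_add_distrib]
    refine Finset.sum_congr rfl fun c _ => ?_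
    rw [Derivation.leibniz,
      hsum K (g := pderiv c f) (fun d hd => by rw [pderiv_comm, hd, map_zero])]
    simp only [smul_eq_mul, Finset.mul_sum, mul_assoc, mul_comm (pderiv c f), add_comm]
  have hsymm : ∑ c ∈ S, ∑ d ∈ S, H c * G d * pderiv d (pderiv c f) =
      ∑ c ∈ S, ∑ d ∈ S, G c * H d * pderiv d (pderiv c f) := by
    rw [Finset.sum_comm]
    simp only [pderiv_comm, mul_comm (H _)]
  rw [Derivation.commutator_apply, happly, happly, hsymm, hsum _ fun _ => id,
    add_sub_add_right_eq_sub, ← Finset.sum_sub_distrib]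
  simp only [sub_mul]

theorem pderiv_vectorField (c : Coord) (G : Coord → SmoothFun) (f : SmoothFun) :
    pderiv c (vectorField G f) =
      vectorField G (pderiv c f) + vectorField (fun d => pderiv c (G d)) f := by
  have hbracket : ⁅pderiv c, vectorField G⁆ f = vectorField (fun d => pderiv c (G d)) f := by
    rw [← vectorField_single, lie_vectorField]
    congr! 3 with d
    obtain rfl | hd := eq_or_ne d c <;> simp [*]
  rw [← hbracket, Derivation.commutator_apply, add_sub_cancel]

theorem finsum_coord {M : Type*} [AddCommMonoid M] {h : Coord → M} (hh : h.HasFiniteSupport) :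
    ∑ᶠ c, h c = h .t + h .x + ∑ᶠ k, h (.u k) + ∑ᶠ k, h (.ut k) := by
  have huniv : univ = insert Coord.t (insert Coord.x (range Coord.u ∪ range Coord.ut)) := by
    ext c
    cases c <;> simp
  have hfin (s : Set Coord) : (s ∩ h.support).Finite := hh.subset inter_subset_right
  have hdisj : Disjoint (range Coord.u) (range Coord.ut) := by
    simp [disjoint_left]
  rw [← finsum_mem_univ, huniv, finsum_mem_insert' _ (by simp) (hfin _),
    finsum_mem_insert' _ (by simp) (hfin _), finsum_mem_union' hdisj (hfin _) (hfin _),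
    finsum_mem_range fun _ _ => Coord.u.inj, finsum_mem_range fun _ _ => Coord.ut.inj]
  simp only [add_assoc]

theorem coe_vectorField_apply (G : Coord → SmoothFun) (f : SmoothFun) (p : JetSpace) :
    vectorField G f p = G .t p * pd .t f p +
      G .x p * pd .x f p + ∑ᶠ k, G (.u k) p * pd (.u k) f p +
      ∑ᶠ k, G (.ut k) p * pd (.ut k) f p := by
  have hfin : (fun c => G c * pderiv c f).HasFiniteSupport :=
    (finite_pderiv_ne_zero f).subset fun c hc => right_ne_zero_of_mul hc
  have hfin' : (fun c => G c p * pd c f p).HasFiniteSupport :=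
    hfin.subset fun c hc h => hc (congrArg (SmoothFun.evalAt p) h)
  rw [vectorField_apply, ← finsum_coord hfin']
  exact map_finsum (SmoothFun.evalAt p) hfin

end VectorFields

section TotalDerivatives

/-- The components of `D_x`, as a vector field. -/
def xVelocity : Coord → SmoothFun
  | .t => 0
  | .x => 1
  | .u k => X (.u (k + 1))
  | .ut k => X (.ut (k + 1))

/-- The total derivative `D_x` as a derivation of the algebra of smooth functions. -/
def totalX : Derivation ℝ SmoothFun SmoothFun := vectorField xVelocity

/-- The damping coefficient `α / t`. -/
def damping (α : ℝ) : SmoothFun := α • tPow (-1)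

/-- The right-hand side of the equation as an element of the algebra of smooth functions. -/
def rhsFun (α : ℝ) : SmoothFun :=
  -X (.u 3) + X (.u 1) * X (.u 2) - damping α * X (.ut 0)

/-- The components of `D_t`, as a vector field. -/
def tVelocity (α : ℝ) : Coord → SmoothFun
  | .t => 1
  | .x => 0
  | .u k => X (.ut k)
  | .ut k => totalX^[k] (rhsFun α)

/-- The total derivative `D_t`, restricted to the equation, as a derivation of the algebra of
smooth functions. -/
def totalT (α : ℝ) : Derivation ℝ SmoothFun SmoothFun := vectorField (tVelocity α)

theorem coe_totalX (f : SmoothFun) : ⇑(totalX f) = Dx f := by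
  funext p
  refine (coe_vectorField_apply _ _ _).trans ?_
  simp [xVelocity, Dx]

theorem coe_iterate_totalX (k : ℕ) (f : SmoothFun) :
    ⇑(totalX^[k] f) = Dx^[k] f :=
  Function.Semiconj.iterate_right coe_totalX k f

theorem coe_rhsFun (α : ℝ) : ⇑(rhsFun α) = rhs α := by
  funext p
  simp [rhsFun, rhs, damping, div_eq_mul_inv, Real.rpow_neg_one, mul_assoc]

theorem coe_totalT (α : ℝ) (f : SmoothFun) : ⇑(totalT α f) = Dt α f := by
  funext p
  refine (coe_vectorField_apply _ _ _).trans ?_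
  simp [tVelocity, Dt, coe_iterate_totalX, coe_rhsFun]

theorem totalX_X (c : Coord) : totalX (X c) = xVelocity c := vectorField_X _ _

theorem totalT_X (α : ℝ) (c : Coord) : totalT α (X c) = tVelocity α c := vectorField_X _ _

theorem totalT_totalX (α : ℝ) (f : SmoothFun) : totalT α (totalX f) = totalX (totalT α f) := by
  rw [← sub_eq_zero, ← Derivation.commutator_apply, totalT, totalX, lie_vectorField]
  refine vectorField_eq_zero fun c => .inl ?_
  change totalT α (xVelocity c) - totalX (tVelocity α c) = 0
  cases c <;>
    simp [xVelocity, tVelocity, totalX_X, totalT_X, Function.iterate_succ_apply']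

theorem totalX_damping (α : ℝ) : totalX (damping α) = 0 := by
  refine vectorField_eq_zero fun c => ?_
  cases c <;> simp [xVelocity, damping, pderiv_tPow]

/-- The two dependent variables `u` and `u_t` of the equation in evolutionary form. -/
inductive DepVar : Type
  | u : DepVar
  | ut : DepVar

/-- The `k`-th `x`-derivative of a dependent variable, as a coordinate. -/
def jet : DepVar → ℕ → Coord
  | .u => .u
  | .ut => .ut

@[simp]
theorem jet_u (k : ℕ) : jet .u k = .u k := rfl

@[simp]
theorem jet_ut (k : ℕ) : jet .ut k = .ut k := rfl

theorem jet_injective (a : DepVar) : (jet a).Injective := by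
  cases a <;> intro j k h <;> simpa using h

variable (a : DepVar)

theorem pderiv_jet_zero_totalX (f : SmoothFun) :
    pderiv (jet a 0) (totalX f) = totalX (pderiv (jet a 0) f) := by
  rw [totalX, pderiv_vectorField, add_eq_left]
  refine vectorField_eq_zero ?_
  rintro (_ | _ | k | k) <;> cases a <;> simp [xVelocity, pderiv_X]

theorem pderiv_jet_succ_totalX (k : ℕ) (f : SmoothFun) :
    pderiv (jet a (k + 1)) (totalX f) =
      totalX (pderiv (jet a (k + 1)) f) + pderiv (jet a k) f := by
  have hvelocity : (fun c => pderiv (jet a (k + 1)) (xVelocity c)) = Pi.single (jet a k) 1 := by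
    funext c
    rcases c with _ | _ | l | l <;> cases a <;>
      simp [xVelocity, pderiv_X, Pi.single_apply, eq_comm]
  rw [totalX, pderiv_vectorField, hvelocity, vectorField_single]

/-- The smooth functions that depend on the `x`-derivatives of `a` of order less than `N` only,
among all `x`-derivatives of `a`. -/
def orderLT (a : DepVar) (N : ℕ) : Subalgebra ℝ SmoothFun := independentOf (jet a '' Ici N)

variable {a : DepVar} {N : ℕ} {f : SmoothFun}

theorem mem_orderLT : f ∈ orderLT a N ↔ ∀ k, N ≤ k → pderiv (jet a k) f = 0 := by
  simp [orderLT, mem_independentOf]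

theorem exists_mem_orderLT (a : DepVar) (f : SmoothFun) : ∃ N, f ∈ orderLT a N := by
  obtain ⟨N, hN⟩ := ((finite_pderiv_ne_zero f).preimage (jet_injective a).injOn).bddAbove
  refine ⟨N + 1, mem_orderLT.2 fun k hk => by_contra fun h => ?_⟩
  exact absurd (hN h) (by omega)

theorem totalX_mem_orderLT (hf : f ∈ orderLT a N) : totalX f ∈ orderLT a (N + 1) := by
  rw [mem_orderLT] at hf ⊢
  rintro (_ | k) hk
  · omega
  · rw [pderiv_jet_succ_totalX, hf _ (by omega), hf _ (by omega), map_zero, add_zero]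

theorem iterate_totalX_mem_orderLT (hf : f ∈ orderLT a N) (j : ℕ) :
    totalX^[j] f ∈ orderLT a (N + j) := by
  induction j with
  | zero => exact hf
  | succ j ih => rw [Function.iterate_succ_apply']; exact totalX_mem_orderLT ih

theorem pderiv_iterate_totalX (hf : f ∈ orderLT a (N + 1)) (j : ℕ) :
    pderiv (jet a (N + j)) (totalX^[j] f) = pderiv (jet a N) f := by
  induction j with
  | zero => rfl
  | succ j ih =>
    have hj := mem_orderLT.1 (iterate_totalX_mem_orderLT hf j) (N + (j + 1)) (by omega)
    rw [Function.iterate_succ_apply', ← add_assoc, pderiv_jet_succ_totalX, add_assoc, hj, map_zero,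
      zero_add, ih]

theorem totalX_mem_orderLT_zero (hf : f ∈ orderLT a 0) : totalX f ∈ orderLT a 0 := by
  rw [mem_orderLT] at hf ⊢
  rintro (_ | k) -
  · rw [pderiv_jet_zero_totalX, hf 0 le_rfl, map_zero]
  · rw [pderiv_jet_succ_totalX, hf _ (Nat.zero_le _), hf _ (Nat.zero_le _), map_zero, add_zero]

end TotalDerivatives

section Euler

/-- Differential operators `∑ aₖ D_xᵏ` in total derivatives, as the families of their
coefficients. -/
abbrev DiffOp : Type := ℕ →₀ SmoothFun

variable {a : DepVar}

/-- The linearization `∑ₖ (∂f/∂aₖ) D_xᵏ` of `f` along the `x`-derivatives `aₖ` of `a`. -/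
def linearization (a : DepVar) : SmoothFun →ₗ[ℝ] DiffOp :=
  (Finsupp.lcomapDomain (R := ℝ) (jet a) (jet_injective a)) ∘ₗ differential.toLinearMap

@[simp]
theorem linearization_apply (f : SmoothFun) (k : ℕ) :
    linearization a f k = pderiv (jet a k) f := rfl

/-- The operator `D_x ∘ L`. -/
def compX : DiffOp →ₗ[ℝ] DiffOp :=
  Finsupp.mapRange.linearMap totalX + Finsupp.lmapDomain SmoothFun ℝ Nat.succ

theorem compX_single (k : ℕ) (a : SmoothFun) :
    compX (.single k a) = .single k (totalX a) + .single (k + 1) a := by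
  simp [compX]

theorem linearization_totalX (f : SmoothFun) :
    linearization a (totalX f) = compX (linearization a f) := by
  ext1 k
  rcases k with _ | k
  · have hsucc : 0 ∉ range Nat.succ := by simp
    simp [compX, pderiv_jet_zero_totalX, Finsupp.mapDomain_of_notMem_range _ _ hsucc]
  · have hsucc := Finsupp.mapDomain_apply Nat.succ_injective (linearization a f) k
    simp_all [compX, pderiv_jet_succ_totalX]

theorem linearization_iterate_totalX (j : ℕ) (f : SmoothFun) :
    linearization a (totalX^[j] f) = compX^[j] (linearization a f) :=
  Function.Semiconj.iterate_right linearization_totalX j f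

/-- The operator `-D_x`. -/
def negX : Module.End ℝ SmoothFun := -totalX.toLinearMap

theorem negX_apply (f : SmoothFun) : negX f = -totalX f := rfl

theorem negX_pow_apply (k : ℕ) (f : SmoothFun) :
    (negX ^ k) f = (-1 : ℝ) ^ k • totalX^[k] f := by
  induction k with
  | zero => simp
  | succ k ih =>
    rw [pow_succ', Module.End.mul_apply, ih, negX_apply, Derivation.map_smul,
      Function.iterate_succ_apply', pow_succ', neg_one_mul, neg_smul]

/-- The formal adjoint `g ↦ ∑ₖ (-D_x)ᵏ (aₖ g)` of the operator `∑ₖ aₖ D_xᵏ`. -/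
def adjoint : DiffOp →ₗ[ℝ] Module.End ℝ SmoothFun :=
  Finsupp.lsum ℝ fun k => LinearMap.mulLeft ℝ (negX ^ k) ∘ₗ LinearMap.mul ℝ SmoothFun

theorem adjoint_single (k : ℕ) (a g : SmoothFun) :
    adjoint (.single k a) g = (negX ^ k) (a * g) := by
  simp [adjoint]

theorem adjoint_compX (L : DiffOp) (g : SmoothFun) :
    adjoint (compX L) g = adjoint L (negX g) := by
  induction L using Finsupp.induction_linear with
  | zero => simp
  | add L M hL hM => simp [hL, hM]
  | single k a =>
    have hleibniz : totalX a * g + negX (a * g) = a * negX g := by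
      simp only [negX_apply, Derivation.leibniz, smul_eq_mul]
      ring
    rw [compX_single, map_add, LinearMap.add_apply, adjoint_single, adjoint_single,
      adjoint_single, pow_succ, Module.End.mul_apply, ← map_add, hleibniz]

theorem adjoint_iterate_compX (j : ℕ) (L : DiffOp) (g : SmoothFun) :
    adjoint (compX^[j] L) g = adjoint L ((negX ^ j) g) := by
  induction j generalizing L with
  | zero => rfl
  | succ j ih =>
    rw [Function.iterate_succ_apply, ih, adjoint_compX, pow_succ', Module.End.mul_apply]

theorem adjoint_smul (b : SmoothFun) (L : DiffOp) (g : SmoothFun) :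
    adjoint (b • L) g = adjoint L (b * g) := by
  induction L using Finsupp.induction_linear with
  | zero => simp
  | add L M hL hM => simp [hL, hM]
  | single k a =>
    rw [Finsupp.smul_single, adjoint_single, adjoint_single, smul_eq_mul, mul_left_comm, mul_assoc]

/-- The Euler operator `f ↦ ∑ₖ (-D_x)ᵏ (∂f/∂aₖ)` of the dependent variable `a`. -/
def euler (a : DepVar) : SmoothFun →ₗ[ℝ] SmoothFun := adjoint.flip 1 ∘ₗ linearization a

theorem euler_apply (f : SmoothFun) : euler a f = adjoint (linearization a f) 1 := rfl

theorem euler_eq_sum {f : SmoothFun} {N : ℕ} (hf : f ∈ orderLT a N) :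
    euler a f = ∑ k ∈ Finset.range N, (-1 : ℝ) ^ k • totalX^[k] (pderiv (jet a k) f) := by
  have hsupp : (linearization a f).support ⊆ Finset.range N := fun k hk => by
    by_contra hkN
    simp_all [mem_orderLT.1 hf k (by simpa using hkN)]
  rw [euler_apply, adjoint, Finsupp.lsum_apply, Finsupp.sum_of_support_subset _ hsupp _ (by simp)]
  simp [negX_pow_apply]

theorem euler_totalX (f : SmoothFun) : euler a (totalX f) = 0 := by
  simp [euler_apply, linearization_totalX, adjoint_compX, negX_apply]

theorem adjoint_smul_of_totalX_eq_zero {b : SmoothFun} (hb : totalX b = 0) (L : DiffOp)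
    (g : SmoothFun) : adjoint (b • L) g = b * adjoint L g := by
  have hnegX (k : ℕ) (f : SmoothFun) : (negX ^ k) (b * f) = b * (negX ^ k) f := by
    induction k with
    | zero => rfl
    | succ k ih =>
      simp only [pow_succ', Module.End.mul_apply, ih, negX_apply, Derivation.leibniz, hb,
        smul_eq_mul, mul_zero, add_zero, mul_neg]
  induction L using Finsupp.induction_linear with
  | zero => simp
  | add L M hL hM => simp [hL, hM, mul_add]
  | single k a =>
    rw [Finsupp.smul_single, adjoint_single, adjoint_single, smul_eq_mul, mul_assoc, hnegX]

theorem totalT_adjoint_one (α : ℝ) (L : DiffOp) : totalT α (adjoint L 1) =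
    adjoint (Finsupp.mapRange.linearMap (totalT α).toLinearMap L) 1 := by
  induction L using Finsupp.induction_linear with
  | zero => simp
  | add L M hL hM => simp only [map_add, LinearMap.add_apply, hL, hM]
  | single k a =>
    have hcomm : totalT α (totalX^[k] a) = totalX^[k] (totalT α a) :=
      Function.Commute.iterate_right (totalT_totalX α) k a
    simp [adjoint_single, negX_pow_apply, hcomm]

variable (α : ℝ)

theorem linearization_ut_rhsFun : linearization .ut (rhsFun α) = .single 0 (-damping α) := by
  ext1 k
  rcases k with _ | k <;> simp [rhsFun, damping, pderiv_X, pderiv_tPow]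

theorem linearization_u_rhsFun : linearization .u (rhsFun α) =
    .single 3 (-1) + .single 2 (X (.u 1)) + .single 1 (X (.u 2)) := by
  ext1 k
  rcases k with _ | _ | _ | _ | k <;> simp [rhsFun, damping, pderiv_X, pderiv_tPow]

theorem linearization_ut_iterate_rhsFun (j : ℕ) :
    linearization .ut (totalX^[j] (rhsFun α)) = .single j (-damping α) := by
  induction j with
  | zero => exact linearization_ut_rhsFun α
  | succ j ih =>
    rw [Function.iterate_succ_apply', linearization_totalX, ih, compX_single, map_neg,
      totalX_damping, neg_zero, Finsupp.single_zero, zero_add]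

theorem pderiv_ut_totalT (k : ℕ) (f : SmoothFun) : pderiv (.ut k) (totalT α f) =
    totalT α (pderiv (.ut k) f) + (pderiv (.u k) f - damping α * pderiv (.ut k) f) := by
  have hut (j : ℕ) : pderiv (.ut k) (totalX^[j] (rhsFun α)) = Finsupp.single j (-damping α) k :=
    DFunLike.congr_fun (linearization_ut_iterate_rhsFun α j) k
  rw [totalT, pderiv_vectorField, add_right_inj, vectorField_eq_sum (S := {.u k, .ut k}),
    Finset.sum_pair (by simp)]
  · simp [tVelocity, pderiv_X, hut, sub_eq_add_neg]
  · rintro (_ | _ | j | j) hj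
    case ut => exact .inl ((hut j).trans (Finsupp.single_eq_of_ne (by grind)))
    all_goals simp_all [tVelocity, pderiv_X, eq_comm]

theorem pderiv_u_totalT (k : ℕ) (f : SmoothFun) :
    pderiv (.u k) (totalT α f) = totalT α (pderiv (.u k) f) +
      (linearization .ut f).sum fun j b => b * pderiv (.u k) (totalX^[j] (rhsFun α)) := by
  rw [totalT, pderiv_vectorField, add_right_inj,
    vectorField_eq_sum (S := (linearization .ut f).support.image (jet .ut)),
    Finset.sum_image (jet_injective .ut).injOn]
  · simp [Finsupp.sum, tVelocity, mul_comm]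
  · rintro (_ | _ | j | j) hj <;> simp_all [tVelocity, pderiv_X]

theorem euler_ut_totalT (f : SmoothFun) : euler .ut (totalT α f) =
    totalT α (euler .ut f) + (euler .u f - damping α * euler .ut f) := by
  have hlin : linearization .ut (totalT α f) =
      Finsupp.mapRange.linearMap (totalT α).toLinearMap (linearization .ut f) +
        (linearization .u f - damping α • linearization .ut f) := by
    ext1 k
    simp [pderiv_ut_totalT]
  simp only [euler_apply, hlin, map_add, map_sub, LinearMap.add_apply, LinearMap.sub_apply,
    totalT_adjoint_one, adjoint_smul_of_totalX_eq_zero (totalX_damping α)]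

theorem adjoint_linearization_u_rhsFun (g : SmoothFun) :
    adjoint (linearization .u (rhsFun α)) g =
      totalX (totalX (totalX g)) + totalX (X (.u 1) * totalX g) := by
  have hX : totalX (X (.u 1)) = X (.u 2) := totalX_X _
  simp only [linearization_u_rhsFun, map_add, LinearMap.add_apply, adjoint_single, pow_succ,
    pow_zero, one_mul, Module.End.mul_apply, negX_apply, Derivation.leibniz, smul_eq_mul, hX,
    neg_mul, map_neg]
  ring

theorem euler_u_totalT (f : SmoothFun) : euler .u (totalT α f) = totalT α (euler .u f) +
    (totalX (totalX (totalX (euler .ut f))) + totalX (X (.u 1) * totalX (euler .ut f))) := by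
  have hlin : linearization .u (totalT α f) =
      Finsupp.mapRange.linearMap (totalT α).toLinearMap (linearization .u f) +
        (linearization .ut f).sum fun j b => b • compX^[j] (linearization .u (rhsFun α)) := by
    ext1 k
    simp [pderiv_u_totalT, Finsupp.sum_apply', ← linearization_iterate_totalX]
  have hadjoint : adjoint ((linearization .ut f).sum fun j b =>
      b • compX^[j] (linearization .u (rhsFun α))) 1 =
        adjoint (linearization .u (rhsFun α)) (euler .ut f) := by
    simp only [Finsupp.sum, map_sum, LinearMap.sum_apply, adjoint_smul, adjoint_iterate_compX]
    simp [euler_apply, adjoint, Finsupp.sum]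
  rw [euler_apply, hlin, map_add, LinearMap.add_apply, hadjoint, ← totalT_adjoint_one,
    ← euler_apply, adjoint_linearization_u_rhsFun]

end Euler

section Cosymmetries

variable {α : ℝ} {f g χ : SmoothFun}

/-- The functions of `t` and `x` only. -/
def basic : Subalgebra ℝ SmoothFun := orderLT .u 0 ⊓ orderLT .ut 0

theorem mem_basic_iff : f ∈ basic ↔ ∀ a k, pderiv (jet a k) f = 0 := by
  constructor
  · rintro ⟨hu, hut⟩ (_ | _) k
    exacts [mem_orderLT.1 hu k (Nat.zero_le k), mem_orderLT.1 hut k (Nat.zero_le k)]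
  · exact fun h => ⟨mem_orderLT.2 fun k _ => h .u k, mem_orderLT.2 fun k _ => h .ut k⟩

theorem pderiv_mem_basic (hf : f ∈ basic) (c : Coord) : pderiv c f ∈ basic :=
  ⟨pderiv_mem_independentOf hf.1 c, pderiv_mem_independentOf hf.2 c⟩

theorem tPow_mem_basic (a : ℝ) : tPow a ∈ basic := by
  rw [mem_basic_iff]
  rintro (_ | _) k <;> simp [pderiv_tPow]

theorem X_t_mem_basic : X .t ∈ basic := tPow_one ▸ tPow_mem_basic 1

theorem damping_mem_basic (α : ℝ) : damping α ∈ basic := basic.smul_mem (tPow_mem_basic _) α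

theorem totalX_of_mem_basic (hf : f ∈ basic) : totalX f = pderiv .x f := by
  rw [totalX, vectorField_eq_sum (S := {.x})]
  · simp [xVelocity]
  · rintro (_ | _ | k | k) hc
    exacts [.inl rfl, (hc (Finset.mem_singleton_self _)).elim, .inr (mem_basic_iff.1 hf .u k),
      .inr (mem_basic_iff.1 hf .ut k)]

theorem totalT_of_mem_basic (hf : f ∈ basic) : totalT α f = pderiv .t f := by
  rw [totalT, vectorField_eq_sum (S := {.t})]
  · simp [tVelocity]
  · rintro (_ | _ | k | k) hc
    exacts [(hc (Finset.mem_singleton_self _)).elim, .inl rfl, .inr (mem_basic_iff.1 hf .u k),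
      .inr (mem_basic_iff.1 hf .ut k)]

theorem totalX_mem_basic (hf : f ∈ basic) : totalX f ∈ basic :=
  totalX_of_mem_basic hf ▸ pderiv_mem_basic hf _

theorem totalT_mem_basic (hf : f ∈ basic) : totalT α f ∈ basic :=
  totalT_of_mem_basic (α := α) hf ▸ pderiv_mem_basic hf _

theorem exists_eq_algebraMap_of_mem_basic (hf : f ∈ basic) (ht : pderiv .t f = 0)
    (hx : pderiv .x f = 0) : ∃ a : ℝ, f = algebraMap ℝ SmoothFun a := by
  refine exists_eq_algebraMap fun c => ?_
  rcases c with _ | _ | k | k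
  exacts [ht, hx, mem_basic_iff.1 hf .u k, mem_basic_iff.1 hf .ut k]

/-- The weights of the coordinates `∂ₓᵏ u` and `∂ₓᵏ u_t`. They are twice the number of
`x`-derivatives, counting `D_t` as `3/2` derivatives because `u_tt = -u_xxx + ⋯`. -/
def weight : DepVar → ℕ → ℕ
  | .u, k => 2 * k
  | .ut, k => 2 * k + 3

/-- The smooth functions that depend on the coordinates of weight less than `N` only, besides `t`
and `x`. -/
def weightLT (N : ℕ) : Subalgebra ℝ SmoothFun :=
  independentOf {c | ∃ a k, jet a k = c ∧ N ≤ weight a k}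

variable {N k : ℕ} {a : DepVar}

theorem mem_weightLT : f ∈ weightLT N ↔ ∀ a k, N ≤ weight a k → pderiv (jet a k) f = 0 := by
  simp only [weightLT, mem_independentOf, mem_ofPred_eq]
  exact ⟨fun h a k hk => h _ ⟨a, k, rfl, hk⟩, by rintro h _ ⟨a, k, rfl, hk⟩; exact h a k hk⟩

theorem weightLT_mono : Monotone weightLT := fun _ _ h _ hf =>
  mem_weightLT.2 fun a k hk => mem_weightLT.1 hf a k (h.trans hk)

theorem basic_eq_weightLT_zero : basic = weightLT 0 := by
  ext f
  simp [mem_basic_iff, mem_weightLT]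

theorem basic_le_weightLT (N : ℕ) : basic ≤ weightLT N :=
  basic_eq_weightLT_zero.trans_le (weightLT_mono (Nat.zero_le N))

theorem mem_orderLT_of_mem_weightLT (hf : f ∈ weightLT (weight a k + 1)) :
    f ∈ orderLT a (k + 1) :=
  mem_orderLT.2 fun j hj => mem_weightLT.1 hf a j <| by cases a <;> simp only [weight] <;> omega

theorem exists_mem_weightLT (f : SmoothFun) : ∃ N, f ∈ weightLT N := by
  obtain ⟨M, hM⟩ := exists_mem_orderLT .u f
  obtain ⟨N, hN⟩ := exists_mem_orderLT .ut f
  refine ⟨2 * M + 2 * N + 3, mem_weightLT.2 ?_⟩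
  rintro (_ | _) k hk <;> simp only [weight] at hk
  exacts [mem_orderLT.1 hM k (by omega), mem_orderLT.1 hN k (by omega)]

theorem totalX_mem_weightLT (hf : f ∈ weightLT N) : totalX f ∈ weightLT (N + 2) := by
  rw [mem_weightLT] at hf ⊢
  rintro a (_ | k) hk
  · rw [pderiv_jet_zero_totalX, hf a 0 (by omega), map_zero]
  · have hweight : weight a (k + 1) = weight a k + 2 := by cases a <;> simp only [weight] <;> omega
    rw [pderiv_jet_succ_totalX, hf a _ (by omega), hf a k (by omega), map_zero, add_zero]

theorem iterate_totalX_mem_weightLT (hf : f ∈ weightLT N) (j : ℕ) :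
    totalX^[j] f ∈ weightLT (N + 2 * j) := by
  induction j with
  | zero => exact hf
  | succ j ih => rw [Function.iterate_succ_apply']; exact totalX_mem_weightLT ih

theorem X_jet_mem_weightLT (h : weight a k < N) : X (jet a k) ∈ weightLT N := by
  refine mem_weightLT.2 fun b l hl => ?_
  rw [pderiv_X, if_neg]
  intro hjet
  cases a <;> cases b <;>
    simp only [weight, jet, reduceCtorEq, Coord.u.injEq, Coord.ut.injEq] at * <;> omega

theorem rhsFun_mem_weightLT (α : ℝ) : rhsFun α ∈ weightLT 7 :=
  have hu (k : ℕ) (hk : k < 4) : X (.u k) ∈ weightLT 7 :=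
    X_jet_mem_weightLT (a := .u) (by simp only [weight]; omega)
  have hut : X (.ut 0) ∈ weightLT 7 := X_jet_mem_weightLT (a := .ut) (by simp [weight])
  sub_mem (add_mem (neg_mem (hu 3 (by norm_num)))
      (mul_mem (hu 1 (by norm_num)) (hu 2 (by norm_num))))
    (mul_mem (basic_le_weightLT _ (damping_mem_basic α)) hut)

theorem tVelocity_jet_mem_weightLT (α : ℝ) (a : DepVar) (k : ℕ) :
    tVelocity α (jet a k) ∈ weightLT (weight a k + 4) := by
  cases a
  · exact X_jet_mem_weightLT (a := .ut) (by simp [weight])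
  · exact weightLT_mono (by simp only [weight]; omega)
      (iterate_totalX_mem_weightLT (rhsFun_mem_weightLT α) k)

theorem totalT_mem_weightLT (hf : f ∈ weightLT N) : totalT α f ∈ weightLT (N + 3) := by
  refine mem_weightLT.2 fun a k hk => ?_
  rw [totalT, pderiv_vectorField, mem_weightLT.1 hf a k (by omega), map_zero, zero_add]
  have hjet (b : DepVar) (l : ℕ) :
      pderiv (jet a k) (tVelocity α (jet b l)) = 0 ∨ pderiv (jet b l) f = 0 := by
    obtain hl | hl := lt_or_ge (weight b l) N
    · exact .inl (mem_weightLT.1 (tVelocity_jet_mem_weightLT α b l) a k (by omega))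
    · exact .inr (mem_weightLT.1 hf b l hl)
  refine vectorField_eq_zero ?_
  rintro (_ | _ | l | l)
  exacts [.inl ((pderiv _).map_one_eq_zero), .inl (map_zero _), hjet .u l, hjet .ut l]

theorem pderiv_u_iterate_rhsFun (α : ℝ) (j : ℕ) :
    pderiv (.u (3 + j)) (totalX^[j] (rhsFun α)) = -1 := by
  refine (pderiv_iterate_totalX (a := .u) ?_ j).trans ?_
  · exact mem_orderLT_of_mem_weightLT (rhsFun_mem_weightLT α)
  · simp [rhsFun, damping, pderiv_X, pderiv_tPow]

theorem pderiv_ut_totalT_of_mem_weightLT (hf : f ∈ weightLT (2 * k + 3)) :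
    pderiv (.ut k) (totalT α f) = pderiv (.u k) f := by
  have hut : pderiv (.ut k) f = 0 := mem_weightLT.1 hf .ut k le_rfl
  rw [pderiv_ut_totalT, hut, map_zero, mul_zero, sub_zero, zero_add]

theorem pderiv_u_totalT_of_mem_weightLT (hf : f ∈ weightLT (2 * k + 4)) :
    pderiv (.u (k + 3)) (totalT α f) = -pderiv (.ut k) f := by
  have hu : pderiv (.u (k + 3)) f = 0 := mem_weightLT.1 hf .u (k + 3) (by simp only [weight]; omega)
  rw [pderiv_u_totalT, hu, map_zero, zero_add, Finsupp.sum,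
    Finset.sum_eq_single k]
  · rw [add_comm k, pderiv_u_iterate_rhsFun, linearization_apply, mul_neg_one, jet_ut]
  · intro j hj hjk
    have hjf : j < k + 1 := by
      by_contra h
      exact Finsupp.mem_support_iff.1 hj (mem_weightLT.1 hf .ut j (by simp only [weight]; omega))
    have hzero : pderiv (.u (k + 3)) (totalX^[j] (rhsFun α)) = 0 :=
      mem_weightLT.1 (tVelocity_jet_mem_weightLT α .ut j) .u (k + 3) (by simp only [weight]; omega)
    rw [hzero, mul_zero]
  · intro hk
    rw [Finsupp.notMem_support_iff.1 hk, zero_mul]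

/-- The equation satisfied by the characteristics of conservation laws. -/
def IsCosymmetry (α : ℝ) (χ : SmoothFun) : Prop :=
  totalT α (totalT α χ) - totalT α (damping α * χ) =
    totalX (totalX (totalX χ)) + totalX (X (.u 1) * totalX χ)

theorem euler_u_of_conserved (h : totalT α f + totalX g = 0) :
    euler .u f = damping α * euler .ut f - totalT α (euler .ut f) := by
  have hut := euler_ut_totalT α f
  rw [eq_neg_of_add_eq_zero_left h, map_neg, euler_totalX] at hut
  linear_combination -hut

theorem isCosymmetry_of_conserved (h : totalT α f + totalX g = 0) :
    IsCosymmetry α (euler .ut f) := by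
  have hu := euler_u_totalT α f
  rw [eq_neg_of_add_eq_zero_left h, map_neg, euler_totalX, euler_u_of_conserved h, map_sub] at hu
  rw [IsCosymmetry]
  linear_combination hu

theorem pderiv_totalT_totalT (α : ℝ) (hf : f ∈ weightLT (weight a k + 1)) :
    pderiv (jet a (k + 3)) (totalT α (totalT α f)) = -pderiv (jet a k) f := by
  have hT : totalT α f ∈ weightLT (weight a k + 4) := totalT_mem_weightLT hf
  cases a
  · exact (pderiv_u_totalT_of_mem_weightLT hT).trans
      (congrArg _ (pderiv_ut_totalT_of_mem_weightLT (weightLT_mono (by simp [weight]) hf)))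
  · exact (pderiv_ut_totalT_of_mem_weightLT (weightLT_mono (by simp only [weight]; omega) hT)).trans
      (pderiv_u_totalT_of_mem_weightLT hf)

theorem IsCosymmetry.pderiv_eq_zero (hχ : IsCosymmetry α χ)
    (h : χ ∈ weightLT (weight a k + 1)) : pderiv (jet a k) χ = 0 := by
  have hvanish {N : ℕ} {g : SmoothFun} (hg : g ∈ weightLT N) (hN : N ≤ weight a k + 6) :
      pderiv (jet a (k + 3)) g = 0 :=
    mem_weightLT.1 hg a (k + 3) (by cases a <;> simp only [weight] at hN ⊢ <;> omega)
  have hdamping : damping α * χ ∈ weightLT (weight a k + 1) :=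
    mul_mem (basic_le_weightLT _ (damping_mem_basic α)) h
  have hprod : X (.u 1) * totalX χ ∈ weightLT (weight a k + 3) :=
    mul_mem (X_jet_mem_weightLT (a := .u) (by simp only [weight]; omega)) (totalX_mem_weightLT h)
  have hXXX : pderiv (jet a (k + 3)) (totalX (totalX (totalX χ))) = pderiv (jet a k) χ :=
    pderiv_iterate_totalX (mem_orderLT_of_mem_weightLT h) 3
  have htop := congrArg (pderiv (jet a (k + 3))) hχ
  rw [map_sub, map_add, pderiv_totalT_totalT α h, hXXX,
    hvanish (totalT_mem_weightLT hdamping) (by omega),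
    hvanish (totalX_mem_weightLT hprod) (by omega), sub_zero, add_zero] at htop
  exact neg_eq_self.1 htop

theorem IsCosymmetry.mem_basic (hχ : IsCosymmetry α χ) : χ ∈ basic := by
  obtain ⟨N, hN⟩ := exists_mem_weightLT χ
  rw [basic_eq_weightLT_zero]
  induction N with
  | zero => exact hN
  | succ N ih =>
    refine ih (mem_weightLT.2 fun a k hk => ?_)
    obtain hk | hk := hk.eq_or_lt
    · exact hχ.pderiv_eq_zero (hk ▸ hN)
    · exact mem_weightLT.1 hN a k hk

theorem IsCosymmetry.pderiv_x_eq_zero (hχ : IsCosymmetry α χ) : pderiv .x χ = 0 := by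
  have hB := hχ.mem_basic
  have hX := totalX_mem_basic hB
  have hmem : totalX (X (.u 1) * totalX χ) ∈ basic := by
    rw [eq_sub_of_add_eq' hχ.symm]
    exact sub_mem (sub_mem (totalT_mem_basic (totalT_mem_basic hB))
      (totalT_mem_basic (mul_mem (damping_mem_basic α) hB)))
      (totalX_mem_basic (totalX_mem_basic hX))
  have hXu (k : ℕ) : pderiv (.u k) (totalX χ) = 0 := mem_basic_iff.1 hX .u k
  have hu2 := pderiv_jet_succ_totalX .u 1 (X (.u 1) * totalX χ)
  rw [mem_basic_iff.1 hmem] at hu2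
  rw [← totalX_of_mem_basic hB]
  simpa [pderiv_X, hXu] using hu2.symm

theorem IsCosymmetry.exists_pderiv_t_sub (hχ : IsCosymmetry α χ) :
    ∃ c : ℝ, pderiv .t χ - damping α * χ = algebraMap ℝ SmoothFun c := by
  have hB := hχ.mem_basic
  have hx := hχ.pderiv_x_eq_zero
  have hdamping : damping α * χ ∈ basic := mul_mem (damping_mem_basic α) hB
  refine exists_eq_algebraMap_of_mem_basic (sub_mem (pderiv_mem_basic hB _) hdamping) ?_ ?_
  · rw [map_sub, ← totalT_of_mem_basic hdamping (α := α),
      ← totalT_of_mem_basic (pderiv_mem_basic hB .t) (α := α),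
      ← totalT_of_mem_basic hB (α := α), hχ, totalX_of_mem_basic hB, hx]
    simp
  · simp [pderiv_comm .x .t, hx, damping, pderiv_tPow]

theorem exists_eq_smul_tPow (hf : f ∈ basic) (hx : pderiv .x f = 0)
    (ht : pderiv .t f = damping α * f) : ∃ a : ℝ, f = a • tPow α := by
  have hpow : pderiv .t (tPow (-α)) = -(damping α * tPow (-α)) := by
    rw [pderiv_tPow, if_pos rfl, damping, smul_mul_assoc, tPow_mul_tPow, neg_smul, sub_eq_neg_add]
  obtain ⟨a, ha⟩ := exists_eq_algebraMap_of_mem_basic (mul_mem (tPow_mem_basic (-α)) hf)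
    (by rw [Derivation.leibniz, ht, hpow, smul_eq_mul, smul_eq_mul]; ring)
    (by simp [hx, pderiv_tPow])
  refine ⟨a, ?_⟩
  calc f = tPow α * (tPow (-α) * f) := by
        rw [← mul_assoc, tPow_mul_tPow, add_neg_cancel, tPow_zero, one_mul]
    _ = a • tPow α := by rw [ha, mul_comm, Algebra.smul_def]

theorem damping_mul_X_t (α : ℝ) : damping α * X .t = algebraMap ℝ SmoothFun α := by
  rw [damping, ← tPow_one, smul_mul_assoc, tPow_mul_tPow, neg_add_cancel, tPow_zero,
    Algebra.algebraMap_eq_smul_one]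

theorem IsCosymmetry.exists_eq (hχ : IsCosymmetry α χ) (hα : α ≠ 1) :
    ∃ a b : ℝ, χ = a • tPow α + b • X .t := by
  obtain ⟨c, hc⟩ := hχ.exists_pderiv_t_sub
  let b := c / (1 - α)
  have hb : b * (1 - α) = c := div_mul_cancel₀ c (sub_ne_zero.2 hα.symm)
  have ht : pderiv .t (χ - b • X .t) = damping α * (χ - b • X .t) := by
    have hbc : b • (1 : SmoothFun) = algebraMap ℝ SmoothFun c + b • algebraMap ℝ SmoothFun α := by
      rw [← hb, Algebra.algebraMap_eq_smul_one, Algebra.algebraMap_eq_smul_one, smul_smul,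
        ← add_smul]
      ring_nf
    rw [map_sub, Derivation.map_smul, pderiv_X, if_pos rfl, mul_sub, mul_smul_comm,
      damping_mul_X_t, hbc, ← hc]
    abel
  obtain ⟨a, ha⟩ := exists_eq_smul_tPow (sub_mem hχ.mem_basic (basic.smul_mem X_t_mem_basic b))
    (by simp [hχ.pderiv_x_eq_zero, pderiv_X]) ht
  exact ⟨a, b, sub_eq_iff_eq_add.1 ha⟩

end Cosymmetries

section Exactness

variable {a b : DepVar} {f g : SmoothFun}

theorem jet_ne_jet (hab : a ≠ b) (j k : ℕ) : jet a j ≠ jet b k := by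
  cases a <;> cases b <;> simp_all

theorem pderiv_pderiv_eq_zero_of_euler_eq_zero {m : ℕ} (hf : f ∈ orderLT a (m + 1))
    (hE : euler a f = 0) : pderiv (jet a m) (pderiv (jet a m) f) = 0 := by
  have hpd (k : ℕ) : pderiv (jet a k) f ∈ orderLT a (m + 1) := pderiv_mem_independentOf hf _
  have htop := congrArg (pderiv (jet a (m + m))) hE
  rw [euler_eq_sum hf, map_zero, map_sum, Finset.sum_range_succ, Finset.sum_eq_zero, zero_add,
    Derivation.map_smul, pderiv_iterate_totalX (hpd m)] at htop
  · simpa using htop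
  · intro k hk
    have hkm := Finset.mem_range.1 hk
    rw [Derivation.map_smul, mem_orderLT.1 (iterate_totalX_mem_orderLT (hpd k) k) _ (by omega),
      smul_zero]

theorem exists_sub_totalX_mem_orderLT {m : ℕ} (hf : f ∈ orderLT a (m + 2))
    (hE : euler a f = 0) : ∃ A, f - totalX A ∈ orderLT a (m + 1) ∧
      ∀ b ≠ a, f ∈ orderLT b 0 → A ∈ orderLT b 0 := by
  obtain ⟨A, hA, hindep⟩ := exists_primitive (jet a m) (pderiv (jet a (m + 1)) f)
  have hAm : A ∈ orderLT a (m + 1) := by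
    refine mem_orderLT.2 fun k hk => hindep _ ((jet_injective a).ne (by omega)) ?_
    obtain rfl | hk := hk.eq_or_lt
    · exact pderiv_pderiv_eq_zero_of_euler_eq_zero hf hE
    · exact mem_orderLT.1 (pderiv_mem_independentOf hf _) k hk
  refine ⟨A, mem_orderLT.2 ?_, fun b hb hfb => mem_orderLT.2 fun k hk =>
    hindep _ (jet_ne_jet hb k m) (mem_orderLT.1 (pderiv_mem_independentOf hfb _) k hk)⟩
  rintro (_ | k) hk
  · omega
  · rw [map_sub, pderiv_jet_succ_totalX, mem_orderLT.1 hAm _ hk, map_zero, zero_add]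
    obtain rfl | hk := (Nat.le_of_succ_le_succ hk).eq_or_lt
    · rw [hA, sub_self]
    · rw [mem_orderLT.1 hf _ (by omega), mem_orderLT.1 hAm _ hk, sub_zero]

theorem exists_sub_totalX_mem_orderLT_zero (hE : euler a f = 0) :
    ∃ L, f - totalX L ∈ orderLT a 0 ∧ ∀ b ≠ a, f ∈ orderLT b 0 → L ∈ orderLT b 0 := by
  obtain ⟨N, hN⟩ := exists_mem_orderLT a f
  induction N generalizing f with
  | zero => exact ⟨0, by simpa using hN, fun b _ _ => zero_mem _⟩
  | succ m ih =>
    rcases m with _ | m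
    · refine ih hE (mem_orderLT.2 fun k _ => ?_)
      rcases k with _ | k
      · simpa [euler_eq_sum hN] using hE
      · exact mem_orderLT.1 hN _ (by omega)
    · obtain ⟨A, hA, hAb⟩ := exists_sub_totalX_mem_orderLT hN hE
      obtain ⟨L, hL, hLb⟩ := ih (by rw [map_sub, hE, euler_totalX, sub_zero]) hA
      refine ⟨A + L, by rwa [map_add, ← sub_sub], fun b hb hfb => ?_⟩
      exact add_mem (hAb b hb hfb)
        (hLb b hb (sub_mem hfb (totalX_mem_orderLT_zero (hAb b hb hfb))))

theorem exists_mem_basic_pderiv_eq (hf : f ∈ basic) {c : Coord} (hc : ∀ a k, jet a k ≠ c) :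
    ∃ F ∈ basic, pderiv c F = f ∧ ∀ d ≠ c, pderiv d f = 0 → pderiv d F = 0 := by
  obtain ⟨F, hF, hindep⟩ := exists_primitive c f
  exact ⟨F, mem_basic_iff.2 fun a k => hindep _ (hc a k) (mem_basic_iff.1 hf a k), hF, hindep⟩

theorem exists_eq_totalX (hu : euler .u f = 0) (hut : euler .ut f = 0) : ∃ L, f = totalX L := by
  obtain ⟨L₁, hf₁, -⟩ := exists_sub_totalX_mem_orderLT_zero hut
  have hu₁ : euler .u (f - totalX L₁) = 0 := by rw [map_sub, hu, euler_totalX, sub_zero]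
  obtain ⟨L₂, hf₂, hL₂⟩ := exists_sub_totalX_mem_orderLT_zero hu₁
  have hbasic : f - totalX L₁ - totalX L₂ ∈ basic :=
    ⟨hf₂, sub_mem hf₁ (totalX_mem_orderLT_zero (hL₂ .ut (by simp) hf₁))⟩
  obtain ⟨L₃, hL₃, hx, -⟩ :=
    exists_mem_basic_pderiv_eq hbasic (c := .x) (by rintro (_ | _) <;> simp)
  refine ⟨L₁ + L₂ + L₃, ?_⟩
  rw [map_add, map_add, totalX_of_mem_basic hL₃, hx]
  abel

theorem mem_orderLT_zero_of_totalX_eq_zero (hf : totalX f = 0) : f ∈ orderLT a 0 := by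
  obtain ⟨N, hN⟩ := exists_mem_orderLT a f
  induction N with
  | zero => exact hN
  | succ N ih =>
    refine ih (mem_orderLT.2 fun k hk => ?_)
    have hsucc := pderiv_jet_succ_totalX a k f
    rwa [hf, mem_orderLT.1 hN _ (by omega), map_zero, map_zero, zero_add, eq_comm] at hsucc

theorem exists_potential {α : ℝ} (h : totalT α f + totalX g = 0) (hf : euler .ut f = 0) :
    ∃ L, f = -totalX L ∧ g = totalT α L := by
  have hu : euler .u f = 0 := by rw [euler_u_of_conserved h, hf, mul_zero, map_zero, sub_zero]
  obtain ⟨L, rfl⟩ := exists_eq_totalX hu hf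
  have hX : totalX (totalT α L + g) = 0 := by rw [map_add, ← totalT_totalX, h]
  have hbasic : totalT α L + g ∈ basic :=
    ⟨mem_orderLT_zero_of_totalX_eq_zero hX, mem_orderLT_zero_of_totalX_eq_zero hX⟩
  have hx : pderiv .x (totalT α L + g) = 0 := by rw [← totalX_of_mem_basic hbasic, hX]
  obtain ⟨H, hH, ht, hindep⟩ :=
    exists_mem_basic_pderiv_eq hbasic (c := .t) (by rintro (_ | _) <;> simp)
  refine ⟨H - L, ?_, ?_⟩
  · rw [map_sub, totalX_of_mem_basic hH, hindep _ (by simp) hx, zero_sub, neg_neg]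
  · rw [map_sub, totalT_of_mem_basic hH, ht, add_sub_cancel_left]

end Exactness

section ConservationLaws

variable {α : ℝ}

theorem isConserved_coe_iff {f g : SmoothFun} :
    IsConserved α (⇑f, ⇑g) ↔ totalT α f + totalX g = 0 := by
  simp only [IsConserved, f.isSmoothFun, g.isSmoothFun, true_and, ← coe_totalT, ← coe_totalX]
  exact DFunLike.coe_injective.eq_iff (a := totalT α f + totalX g) (b := 0)

theorem isTrivial_coe_iff {f g : SmoothFun} :
    IsTrivial α (⇑f, ⇑g) ↔ ∃ L, f = -totalX L ∧ g = totalT α L := by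
  have hcoe (L : SmoothFun) :
      (⇑f = -Dx L ∧ ⇑g = Dt α L) ↔ (f = -totalX L ∧ g = totalT α L) := by
    rw [← coe_totalX, ← coe_totalT, ← SmoothFun.coe_neg, DFunLike.coe_fn_eq, DFunLike.coe_fn_eq]
  exact ⟨fun ⟨L, hL, h⟩ => ⟨hL.toSmoothFun, (hcoe _).1 h⟩,
    fun ⟨L, h⟩ => ⟨L, L.isSmoothFun, (hcoe L).2 h⟩⟩

theorem IsConserved.exists_eq {J : Current} (hJ : IsConserved α J) :
    ∃ f g : SmoothFun, J = (⇑f, ⇑g) :=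
  ⟨hJ.1.toSmoothFun, hJ.2.1.toSmoothFun, rfl⟩

theorem characteristic_coe (f : SmoothFun) (g : JetSpace → ℝ) :
    characteristic (⇑f, g) = euler .ut f := by
  obtain ⟨N, hN⟩ := exists_mem_orderLT .ut f
  funext p
  simp only [characteristic, ← coe_pderiv, ← coe_iterate_totalX]
  rw [finsum_eq_sum_of_support_subset (s := Finset.range N), euler_eq_sum hN]
  · exact (map_sum (SmoothFun.evalAt p)
      (fun k => (-1 : ℝ) ^ k • totalX^[k] (pderiv (.ut k) f)) _).symm
  · refine Function.support_subset_iff'.2 fun k hk => ?_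
    have hut : pderiv (.ut k) f = 0 := mem_orderLT.1 hN k (by simpa using hk)
    simp [hut]

theorem isCharacteristicOf_coe (f g : SmoothFun) :
    IsCharacteristicOf α (⇑f, ⇑g) (euler .ut f) := by
  intro J' hJ' h
  obtain ⟨f', g', rfl⟩ := hJ'.exists_eq
  obtain ⟨L, hL, -⟩ := isTrivial_coe_iff (f := f' - f) (g := g' - g) |>.1 h
  rw [characteristic_coe, ← sub_add_cancel f' f, hL, map_add, map_neg, euler_totalX, neg_zero,
    zero_add]

/-- The density `u_t t^α` of the first current. -/
def densityA (α : ℝ) : SmoothFun := X (.ut 0) * tPow α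

/-- The density `u_t t + (α - 1) u` of the second current. -/
def densityB (α : ℝ) : SmoothFun := X (.ut 0) * X .t + (α - 1) • X (.u 0)

/-- The flux `(u_xx - u_x² / 2) τ` of the two currents, where `τ` is `t^α` or `t`. -/
def flux (τ : SmoothFun) : SmoothFun := (X (.u 2) - (1 / 2 : ℝ) • X (.u 1) ^ 2) * τ

theorem currentA_eq (α : ℝ) : currentA α = (⇑(densityA α), ⇑(flux (tPow α))) := by
  refine Prod.ext (funext fun p => ?_) (funext fun p => ?_)
  · simp [currentA, densityA]
  · simp [currentA, flux, pow_two]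
    ring

theorem currentB_eq (α : ℝ) : currentB α = (⇑(densityB α), ⇑(flux (X .t))) := by
  refine Prod.ext (funext fun p => ?_) (funext fun p => ?_)
  · simp [currentB, densityB]
  · simp [currentB, flux, pow_two]
    ring

theorem totalX_flux {τ : SmoothFun} (hτ : totalX τ = 0) :
    totalX (flux τ) = -(rhsFun α + damping α * X (.ut 0)) * τ := by
  have h1 : totalX (X (.u 1)) = X (.u 2) := totalX_X _
  have h2 : totalX (X (.u 2)) = X (.u 3) := totalX_X _
  have hsq : totalX ((1 / 2 : ℝ) • X (.u 1) ^ 2) = X (.u 1) * X (.u 2) := by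
    rw [Derivation.map_smul, pow_two, Derivation.leibniz, h1, smul_eq_mul, ← two_smul ℝ, smul_smul]
    norm_num
  rw [flux, Derivation.leibniz, hτ, map_sub, h2, hsq, rhsFun]
  simp only [smul_eq_mul]
  ring

theorem totalX_tPow (a : ℝ) : totalX (tPow a) = 0 := by
  simp [totalX_of_mem_basic (tPow_mem_basic a), pderiv_tPow]

theorem totalT_tPow (α a : ℝ) : totalT α (tPow a) = a • tPow (a - 1) := by
  simp [totalT_of_mem_basic (tPow_mem_basic a), pderiv_tPow]

theorem totalT_densityA (α : ℝ) :
    totalT α (densityA α) = (rhsFun α + damping α * X (.ut 0)) * tPow α := by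
  have hut : totalT α (X (.ut 0)) = rhsFun α := totalT_X α _
  have hpow : damping α * tPow α = α • tPow (α - 1) := by
    rw [damping, smul_mul_assoc, tPow_mul_tPow, neg_add_eq_sub]
  rw [densityA, Derivation.leibniz, totalT_tPow, hut, ← hpow]
  simp only [smul_eq_mul]
  ring

theorem totalT_densityB (α : ℝ) :
    totalT α (densityB α) = (rhsFun α + damping α * X (.ut 0)) * X .t := by
  have hut : totalT α (X (.ut 0)) = rhsFun α := totalT_X α _
  have hu : totalT α (X (.u 0)) = X (.ut 0) := totalT_X α _
  have ht : totalT α (X .t) = 1 := totalT_X α _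
  rw [densityB, map_add, Derivation.map_smul, Derivation.leibniz, hut, hu, ht, add_mul,
    mul_right_comm, damping_mul_X_t, ← Algebra.smul_def]
  simp only [smul_eq_mul, sub_smul, one_smul, mul_one, mul_comm (X .t)]
  abel

theorem conserved_densityA (α : ℝ) : totalT α (densityA α) + totalX (flux (tPow α)) = 0 := by
  rw [totalT_densityA, totalX_flux (totalX_tPow α), neg_mul, add_neg_cancel]

theorem conserved_densityB (α : ℝ) : totalT α (densityB α) + totalX (flux (X .t)) = 0 := by
  rw [totalT_densityB, totalX_flux (totalX_X .t), neg_mul, add_neg_cancel]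

theorem euler_ut_X_mul {τ : SmoothFun} (hτ : τ ∈ basic) : euler .ut (X (.ut 0) * τ) = τ := by
  have hτk (k : ℕ) : pderiv (.ut k) τ = 0 := mem_basic_iff.1 hτ .ut k
  have hmem : X (.ut 0) * τ ∈ orderLT .ut 1 := by
    refine mem_orderLT.2 fun k hk => ?_
    have hk0 : k ≠ 0 := by omega
    simp [hτk, pderiv_X, hk0]
  simp [euler_eq_sum hmem, hτk, pderiv_X]

theorem euler_ut_densityA (α : ℝ) : euler .ut (densityA α) = tPow α :=
  euler_ut_X_mul (tPow_mem_basic α)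

theorem euler_ut_densityB (α : ℝ) : euler .ut (densityB α) = X .t := by
  have hu : X (.u 0) ∈ orderLT .ut 0 := mem_orderLT.2 fun k _ => by simp [pderiv_X]
  rw [densityB, map_add, map_smul, euler_ut_X_mul X_t_mem_basic, euler_eq_sum hu]
  simp

theorem isConserved_currentA (α : ℝ) : IsConserved α (currentA α) :=
  currentA_eq α ▸ isConserved_coe_iff.2 (conserved_densityA α)

theorem isConserved_currentB (α : ℝ) : IsConserved α (currentB α) :=
  currentB_eq α ▸ isConserved_coe_iff.2 (conserved_densityB α)

theorem isCharacteristicOf_currentA (α : ℝ) :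
    IsCharacteristicOf α (currentA α) fun p => coord .t p ^ α := by
  rw [currentA_eq, ← coe_tPow, ← euler_ut_densityA]
  exact isCharacteristicOf_coe _ _

theorem isCharacteristicOf_currentB (α : ℝ) :
    IsCharacteristicOf α (currentB α) fun p => coord .t p := by
  rw [currentB_eq, ← coe_X, ← euler_ut_densityB α]
  exact isCharacteristicOf_coe _ _

theorem IsConserved.exists_equivalent {J : Current} (hJ : IsConserved α J) (hα : α ≠ 1) :
    ∃ a b : ℝ, Equivalent α J (a • currentA α + b • currentB α) := by
  obtain ⟨f, g, rfl⟩ := hJ.exists_eq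
  have h := isConserved_coe_iff.1 hJ
  obtain ⟨a, b, hχ⟩ := (isCosymmetry_of_conserved h).exists_eq hα
  refine ⟨a, b, ?_⟩
  rw [Equivalent, currentA_eq, currentB_eq]
  refine isTrivial_coe_iff (f := f - (a • densityA α + b • densityB α))
    (g := g - (a • flux (tPow α) + b • flux (X .t))) |>.2 (exists_potential ?_ ?_)
  · simp only [map_add, map_sub, Derivation.map_smul]
    linear_combination (norm := module) h - a • conserved_densityA α - b • conserved_densityB α
  · rw [map_sub, map_add, map_smul, map_smul, euler_ut_densityA, euler_ut_densityB, hχ, sub_self]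

end ConservationLaws

end ViscousTransonic

end

theorem mainTheorem8 (α : ℝ) :
    ViscousTransonic.IsConserved α (ViscousTransonic.currentA α) ∧
    ViscousTransonic.IsConserved α (ViscousTransonic.currentB α) ∧
    ViscousTransonic.IsCharacteristicOf α (ViscousTransonic.currentA α)
      (fun p => ViscousTransonic.coord ViscousTransonic.Coord.t p ^ α) ∧
    ViscousTransonic.IsCharacteristicOf α (ViscousTransonic.currentB α)
      (fun p => ViscousTransonic.coord ViscousTransonic.Coord.t p) ∧
    (α ≠ 1 → ∀ J : ViscousTransonic.Current, ViscousTransonic.IsConserved α J →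
      ∃ a b : ℝ, ViscousTransonic.Equivalent α J
        (a • ViscousTransonic.currentA α + b • ViscousTransonic.currentB α)) := by
  open ViscousTransonic in
  exact ⟨isConserved_currentA α, isConserved_currentB α, isCharacteristicOf_currentA α,
    isCharacteristicOf_currentB α, fun hα J hJ => hJ.exists_equivalent hα⟩
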